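/- Let $F$ be an infinite field. A finite sequence $H=(h_0,\dots,h_j)$ of natural numbers is \emph{log-concave in degree $i$} ($1\le i\le j-1$) if $h_{i-1}h_{i+1}\le h_i^2$, and log-concave if this holds for all such $i$; its length is $n=\sum_i h_i$. A sequence $(d_0,\dots,d_m)$ of nonnegative integers is a \emph{Macaulay sequence} if $d_0=1$ and, for $1\le a<m$, $d_{a+1}\le d_a^{(a)}:=\sum_{i=1}^a\binom{n_i+1}{i+1}$, where $d_a=\sum_{i=1}^a\binom{n_i}{i}$ with $n_a>\dots>n_1\ge 0$. $H$ is an \emph{SI sequence} of codimension $r$ and socle degree $j$ if $h_0=1$, $h_1=r$, $h_i=h_{j-i}$ for all $i$, and the first differences $(h_i-h_{i-1})_{0\le i\le \lfloor j/2\rfloor}$ (with $h_{-1}=0$) form a Macaulay sequence. $H$ is a \emph{Gorenstein sequence} of codimension $r$ over $F$ if $h_1=r$ and $H$ is the Hilbert function of a graded Artinian Gorenstein quotient of $F[x_1,\dots,x_r]$ (by a homogeneous ideal, with one-dimensional socle). Put $s_k=\binom{k+3}{3}$, and for natural numbers $\delta\geq 1$, $k$, $b$ let $$H(\delta,k,b)=(s_0,s_1,\dots,s_k,\,s_k+b,\,s_k+2b+\delta,\,s_k+b,\,s_k,\dots,s_1,s_0),$$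 a symmetric sequence with last degree $2k+4$. Call $(h_k,\dots,h_{k+4})$ its key entries. Say that $H(\delta,k,b)$ is \emph{good} if it is a codimension four SI sequence of socle degree $2k+4$, is a codimension four Gorenstein sequence over $F$, and is not log-concave in degree $k+1$. Then there are codimension four SI sequences that are Gorenstein sequences over $F$ and are not log-concave. More precisely: (General triples.) If $1\le\delta\le k+1$, $b\ge \delta(k+1)-\delta(\delta-3)/2$ and $\delta s_k>b^2$, then $H(\delta,k,b)$ is good, with key entries $(s_k,s_k+b,s_k+2b+\delta,s_k+b,s_k)$ and length $2\binom{k+4}{4}+3s_k+4b+\delta$. Conversely, if $\delta\ge1$ and $H(\delta,k,b)$ is a codimension four SI sequence that is not log-concave in degree $k+1$, then $\delta\le k+1$, $b\ge \delta(k+1)-\delta(\delta-3)/2$ and $\delta s_k>b^2$. (Case $\delta=1$.) $H(1,5,7)=(1,4,10,20,35,56,63,71,63,56,35,20,10,4,1)$ is good (not log-concave in degree $6$), of length $449$; every SI sequence $H(1,k,b)$ of codimension four that is not log-concave in degree $k+1$ has $k\ge5$ and $b\ge 7$. $H(1,6,8)=(1,4,10,20,35,56,84,92,101,92,84,56,35,20,10,4,1)$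 is good, of length $705$. $H(1,6,9)$ is good, with key entries $(84,93,103,93,84)$ and length $709$. If $k+2\le b\le (k/6)^{3/2}$ then $H(1,k,b)$ is good, and for all large $k$ there is such a $b$. (Case $\delta=2$.) $H(2,10,23)$ is good, with key entries $(286,309,334,309,286)$ and length $2954$; every SI sequence $H(2,k,b)$ of codimension four that is not log-concave in degree $k+1$ has $k\ge 10$ and $b\ge 23$. $H(2,11,25)$ is good, with key entries $(364,389,416,389,364)$ and length $3924$. $H(2,11,26)$ is good, with key entries $(364,390,418,390,364)$. $H(2,12,b)$ is good for $27\le b\le 30$, and for $b=27$ has key entries $(455,482,511,482,455)$. For every $k\ge10$ we have $2s_k>(2k+3)^2$, and $H(2,k,2k+3)$ is good, with key entries $(s_k,s_k+2k+3,s_k+4k+8,s_k+2k+3,s_k)$ and length $2\binom{k+4}{4}+3s_k+8k+14$. If $2k+3\le b<\sqrt{2s_k}$, then $H(2,k,b)$ is good, with key entries $(s_k,s_k+b,s_k+2b+2,s_k+b,s_k)$ and length $2\binom{k+4}{4}+3s_k+4b+2$. For $k=25$, $\lfloor\sqrt{2s_{25}}\rfloor=80$, and $H(2,25,80)$ is good.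 (Case $\delta=3$.) $H(3,14,45)$ is good, with key entries $(680,725,773,725,680)$; every SI sequence $H(3,k,b)$ of codimension four that is not log-concave in degree $k+1$ has $k\ge14$ and $b\ge 45$. $H(3,17,57)$ is good, with key entries $(1140,1197,1257,1197,1140)$; $H(3,18,57)$ is good, with key entries $(1330,1387,1447,1387,1330)$. (Case $\delta\ge4$.) If $\delta\ge4$, $k\ge1$, $b\ge\delta(k+1)-\delta(\delta-3)/2$ and $\delta k\le b\le \delta^{1/2}k^{3/2}/6^{3/2}$, then $H(\delta,k,b)$ is good. For $\delta\ge5$ the condition $b\ge \delta k$ implies $b\ge\delta(k+1)-\delta(\delta-3)/2$. For each $\delta\ge4$ and all large $k$ there is a $b$ satisfying these conditions. -/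

import Mathlib

open Finset

/-! ### Sequences

A finite sequence `(h_0, …, h_j)` is a function `h : ℕ → ℕ` that vanishes beyond `j`. -/

/-- The finite sequence with the entries of `L`. -/
def seqOfList (L : List ℕ) : ℕ → ℕ := fun i => L.getD i 0

/-- Log-concavity of `h` in a degree `i ≥ 1`. -/
def LogConcaveAt (h : ℕ → ℕ) (i : ℕ) : Prop := h (i - 1) * h (i + 1) ≤ h i ^ 2

/-- Log-concavity of `(h_0, …, h_j)`: log-concavity in each degree `i ∈ [1, j - 1]`. -/
def IsLogConcave (h : ℕ → ℕ) (j : ℕ) : Prop := ∀ i, 1 ≤ i → i + 1 ≤ j → LogConcaveAt h i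

/-- `v = ∑_{i=1}^a C(n_i, i)` with `n_a > n_{a-1} > ⋯ > n_1 ≥ 0`
(for each `v ≥ 0` and `a ≥ 1` there is exactly one such `(n_1, …, n_a)`). -/
def IsMacaulayExpansion (a : ℕ) (v : ℤ) (n : ℕ → ℕ) : Prop :=
  (∀ i, 1 ≤ i → i < a → n i < n (i + 1)) ∧
    v = ((∑ i ∈ Icc 1 a, (n i).choose i : ℕ) : ℤ)

/-- `(d_0, …, d_m)` is a Macaulay sequence: nonnegative, `d_0 = 1`, and `d_{a+1} ≤ d_a^{(a)}`
for `1 ≤ a < m`, where `d_a^{(a)} = ∑_{i=1}^a C(n_i + 1, i + 1)` for the Macaulay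
expansion `d_a = ∑_{i=1}^a C(n_i, i)`. -/
def IsMacaulaySequence (m : ℕ) (d : ℕ → ℤ) : Prop :=
  d 0 = 1 ∧ (∀ a, a ≤ m → 0 ≤ d a) ∧
    ∀ a, 1 ≤ a → a < m → ∃ n : ℕ → ℕ, IsMacaulayExpansion a (d a) n ∧
      d (a + 1) ≤ ((∑ i ∈ Icc 1 a, (n i + 1).choose (i + 1) : ℕ) : ℤ)

/-- The first difference `(ΔH)_i = h_i - h_{i-1}`, with `h_{-1} = 0`. -/
def firstDiff (h : ℕ → ℕ) : ℕ → ℤ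
  | 0 => h 0
  | i + 1 => (h (i + 1) : ℤ) - h i

/-- `(h_0, …, h_j)` is an SI sequence of socle degree `j` and codimension `r`. -/
def IsSISequence (r j : ℕ) (h : ℕ → ℕ) : Prop :=
  h 0 = 1 ∧ h 1 = r ∧ (∀ i, i ≤ j → h i = h (j - i)) ∧ (∀ i, j < i → h i = 0) ∧
    IsMacaulaySequence (j / 2) (firstDiff h)

/-! ### Graded Artinian Gorenstein algebras -/

section Gorenstein

attribute [local instance] MvPolynomial.gradedAlgebra

variable {F : Type*} [Field F] {r : ℕ}

/-- `dim_F A_i` for `A = F[x_1, …, x_r] / I` (meant for a homogeneous ideal `I`). -/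
noncomputable def hilbertFn (I : Ideal (MvPolynomial (Fin r) F)) (i : ℕ) : ℕ :=
  Module.finrank F
    ((MvPolynomial.homogeneousSubmodule (Fin r) F i).map (Ideal.Quotient.mkₐ F I).toLinearMap)

/-- The ideal `𝔪_A` of `A = F[x_1, …, x_r] / I` generated by the classes of the variables. -/
noncomputable def irrelevantIdeal (I : Ideal (MvPolynomial (Fin r) F)) :
    Ideal (MvPolynomial (Fin r) F ⧸ I) :=
  Ideal.span (Set.range fun x : Fin r => Ideal.Quotient.mk I (MvPolynomial.X x))

/-- The socle `(0 : 𝔪_A)` of `A = F[x_1, …, x_r] / I`. -/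
noncomputable def socle (I : Ideal (MvPolynomial (Fin r) F)) :
    Ideal (MvPolynomial (Fin r) F ⧸ I) :=
  Submodule.annihilator (irrelevantIdeal I)

/-- `F[x_1, …, x_r] / I` is a graded Artinian Gorenstein algebra: `I` is homogeneous, the quotient
is Artinian, and its socle has dimension one. -/
def IsGradedArtinianGorenstein (I : Ideal (MvPolynomial (Fin r) F)) : Prop :=
  I.IsHomogeneous (MvPolynomial.homogeneousSubmodule (Fin r) F) ∧
    IsArtinianRing (MvPolynomial (Fin r) F ⧸ I) ∧
    Module.finrank F (socle I) = 1

end Gorenstein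

/-- `h` is the Hilbert function of a graded Artinian Gorenstein `F`-algebra of codimension `r`. -/
def IsGorensteinSequence (F : Type*) [Field F] (r : ℕ) (h : ℕ → ℕ) : Prop :=
  h 1 = r ∧ ∃ I : Ideal (MvPolynomial (Fin r) F),
    IsGradedArtinianGorenstein I ∧ ∀ i, hilbertFn I i = h i

/-- `h` is a codimension four SI sequence of socle degree `j`, a Gorenstein sequence over `F`,
and not log-concave in degree `i`, where `1 ≤ i ≤ j - 1`. -/
def IsNonLogConcaveExample (F : Type*) [Field F] (j i : ℕ) (h : ℕ → ℕ) : Prop :=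
  IsSISequence 4 j h ∧ IsGorensteinSequence F 4 h ∧ 1 ≤ i ∧ i + 1 ≤ j ∧ ¬ LogConcaveAt h i

/-! ### The sequences attached to triples `(δ, k, b)` -/

/-- `s_k = C(k + 3, 3)`, the dimension of the forms of degree `k` in four variables. -/
def sdim (k : ℕ) : ℕ := (k + 3).choose 3

/-- `(s_0, s_1, …, s_k, s_k + b, s_k + 2b + δ, s_k + b, s_k, …, s_1, s_0)`, of socle
degree `2k + 4`. -/
def tripleSeq (δ k b : ℕ) : ℕ → ℕ := fun i =>
  if i ≤ k then sdim i
  else if i = k + 1 then sdim k + b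
  else if i = k + 2 then sdim k + 2 * b + δ
  else if i = k + 3 then sdim k + b
  else if i ≤ 2 * k + 4 then sdim (2 * k + 4 - i)
  else 0

/-- The entries `(h_k, …, h_{k+4})`. -/
def keyEntries (h : ℕ → ℕ) (k : ℕ) : List ℕ := [h k, h (k + 1), h (k + 2), h (k + 3), h (k + 4)]

/-- The length `n = h_0 + ⋯ + h_j`. -/
def seqLength (h : ℕ → ℕ) (j : ℕ) : ℕ := ∑ i ∈ range (j + 1), h i

/-- `b ≥ δ a - δ (δ - 3) / 2`, where `a = k + 1`. -/
def MeetsBound (δ k b : ℕ) : Prop :=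
  (δ : ℚ) * (k + 1) - δ * (δ - 3) / 2 ≤ b

/-! For points indexed by a finite set Z, let φ send a polynomial to the sum over Z of the values of
its degree j component. The largest ideal inside ker φ is graded, with Artinian quotient, and if φ ≠
0 the socle is a line. If forms of degree τ already take all values on Z and j ≥ 2τ, then the
Hilbert function of the quotient in degree i ≤ j is that of Z in degree min(i, j - i).

Suitable points come from a finite lower set D of exponents, through the grid points (1, t_{α 1}, …,
t_{α m}) with α in D. Newton polynomials are triangular on this grid, so the forms of degree n have
a space of values of dimension #{β ∈ D : |β| ≤ n} (`finrank_formValues_gridPoint`). Existence thus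
becomes combinatorial: D must have C(d+2, 2) elements in each degree d ≤ k, then b, then b + δ. Take
a lower set B of b pairs (v, w), use B as the layer in degree k + 1, and use B together with δ new
monomials y^v z^w as the layer in degree k + 2. This D is a lower set as soon as B contains `slab (k
+ 1) δ`, whose cardinality is the bound in `MeetsBound`.

The same number is the threshold at which Macaulay growth of b in degree k + 1 reaches b + δ
(`exists_expansion_growth`, `le_of_expansion_growth`). This gives the SI property and its converse.
Failure of log-concavity in degree k + 1 amounts to b² < δ s_k, so all the listed cases and ranges
reduce to arithmetic with these inequalities. -/

/-! ### Gorenstein algebras from finite sets of points -/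

section PointFunctional

variable {F : Type*} [Field F] {r : ℕ} {Z : Type*}

/-- Evaluation of polynomials on a family of points. -/
noncomputable def evalOn (p : Z → Fin r → F) : MvPolynomial (Fin r) F →ₗ[F] (Z → F) :=
  LinearMap.pi fun z => (MvPolynomial.aeval (R := F) (p z)).toLinearMap

@[simp]
theorem evalOn_apply (p : Z → Fin r → F) (f : MvPolynomial (Fin r) F) (z : Z) :
    evalOn p f z = MvPolynomial.eval (p z) f := by
  simp [evalOn, MvPolynomial.aeval_eq_eval]

theorem evalOn_mul (p : Z → Fin r → F) (f g : MvPolynomial (Fin r) F) :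
    evalOn p (f * g) = evalOn p f * evalOn p g := by
  ext z; simp

/-- The values on a family of points of the forms of degree `i`. -/
noncomputable def formValues (p : Z → Fin r → F) (i : ℕ) : Submodule F (Z → F) :=
  (MvPolynomial.homogeneousSubmodule (Fin r) F i).map (evalOn p)

variable [Fintype Z]

/-- The sum over a family of points of the values of the degree `j` component. -/
noncomputable def pointFunctional (p : Z → Fin r → F) (j : ℕ) : MvPolynomial (Fin r) F →ₗ[F] F :=
  (∑ z, LinearMap.proj z) ∘ₗ evalOn p ∘ₗ MvPolynomial.homogeneousComponent j

theorem pointFunctional_apply (p : Z → Fin r → F) (j : ℕ) (f : MvPolynomial (Fin r) F) :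
    pointFunctional p j f = ∑ z, evalOn p (MvPolynomial.homogeneousComponent j f) z := by
  simp [pointFunctional]

/-- The largest ideal in the kernel of a linear functional. -/
def idealOfFunctional (φ : MvPolynomial (Fin r) F →ₗ[F] F) : Ideal (MvPolynomial (Fin r) F) where
  carrier := {f | ∀ g, φ (f * g) = 0}
  add_mem' hf hg h := by rw [add_mul, map_add, hf h, hg h, add_zero]
  zero_mem' h := by simp
  smul_mem' c f hf h := by
    rw [smul_eq_mul, mul_comm c f, mul_assoc]; exact hf _

theorem mem_idealOfFunctional {φ : MvPolynomial (Fin r) F →ₗ[F] F} {f : MvPolynomial (Fin r) F} :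
    f ∈ idealOfFunctional φ ↔ ∀ g, φ (f * g) = 0 := Iff.rfl

theorem homogeneousComponent_mul_of_isHomogeneous {f : MvPolynomial (Fin r) F} {i j : ℕ}
    (hf : f.IsHomogeneous i) (hij : i ≤ j) (g : MvPolynomial (Fin r) F) :
    MvPolynomial.homogeneousComponent j (f * g) =
      f * MvPolynomial.homogeneousComponent (j - i) g := by
  conv_lhs => rw [← MvPolynomial.sum_homogeneousComponent g]
  rw [Finset.mul_sum, map_sum]
  have h : ∀ a ∈ range (g.totalDegree + 1), MvPolynomial.homogeneousComponent j
      (f * MvPolynomial.homogeneousComponent a g) =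
      if a = j - i then f * MvPolynomial.homogeneousComponent (j - i) g else 0 := by
    intro a _
    rw [MvPolynomial.homogeneousComponent_of_mem (m := j)
      (hf.mul (MvPolynomial.homogeneousComponent_isHomogeneous a g))]
    by_cases h : a = j - i
    · subst h; simp [Nat.add_sub_cancel' hij]
    · rw [if_neg h, if_neg]; omega
  rw [Finset.sum_congr rfl h, Finset.sum_ite_eq']
  split_ifs with h'
  · rfl
  · rw [MvPolynomial.homogeneousComponent_eq_zero, mul_zero]
    have := h'
    simp only [Finset.mem_range] at this
    omega

theorem homogeneousComponent_mul_of_lt {f : MvPolynomial (Fin r) F} {i j : ℕ}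
    (hf : f.IsHomogeneous i) (hij : j < i) (g : MvPolynomial (Fin r) F) :
    MvPolynomial.homogeneousComponent j (f * g) = 0 := by
  conv_lhs => rw [← MvPolynomial.sum_homogeneousComponent g]
  rw [Finset.mul_sum, map_sum]
  refine Finset.sum_eq_zero fun a _ => ?_
  rw [MvPolynomial.homogeneousComponent_of_mem (m := j)
      (hf.mul (MvPolynomial.homogeneousComponent_isHomogeneous a g)), if_neg (by omega)]

variable (p : Z → Fin r → F) (j : ℕ)

theorem mem_idealOfFunctional_of_lt {i : ℕ} (hij : j < i) {f : MvPolynomial (Fin r) F}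
    (hf : f.IsHomogeneous i) : f ∈ idealOfFunctional (pointFunctional p j) := fun g => by
  rw [pointFunctional_apply, homogeneousComponent_mul_of_lt hf hij]; simp

/-- Only the component of degree j - i of the cofactor contributes to φ, so membership is
orthogonality for the standard pairing on `Z → F`. This reduces the Hilbert function to linear
algebra. -/
theorem mem_idealOfFunctional_iff {i : ℕ} (hij : i ≤ j) {f : MvPolynomial (Fin r) F}
    (hf : f.IsHomogeneous i) : f ∈ idealOfFunctional (pointFunctional p j) ↔
      ∀ w ∈ formValues p (j - i), ∑ z, evalOn p f z * w z = 0 := by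
  rw [mem_idealOfFunctional]
  constructor
  · rintro h _ ⟨g, hg, rfl⟩
    have := h g
    rw [pointFunctional_apply, homogeneousComponent_mul_of_isHomogeneous hf hij,
      MvPolynomial.homogeneousComponent_eq_self hg] at this
    simpa [evalOn_mul] using this
  · intro h g
    rw [pointFunctional_apply, homogeneousComponent_mul_of_isHomogeneous hf hij]
    simpa [evalOn_mul] using h _ ⟨_, MvPolynomial.homogeneousComponent_isHomogeneous (j - i) g, rfl⟩

-- Gradedness, finiteness and socle of the quotient

attribute [local instance] MvPolynomial.gradedAlgebra

theorem isHomogeneous_idealOfFunctional :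
    (idealOfFunctional (pointFunctional p j)).IsHomogeneous
      (MvPolynomial.homogeneousSubmodule (Fin r) F) := by
  intro i f hf
  have hdec : (DirectSum.decompose (MvPolynomial.homogeneousSubmodule (Fin r) F) f i :
      MvPolynomial (Fin r) F) = MvPolynomial.homogeneousComponent i f :=
    MvPolynomial.decomposition.decompose'_apply f i
  rw [hdec]
  rcases lt_or_ge j i with hij | hij
  · exact mem_idealOfFunctional_of_lt p j hij
      (MvPolynomial.homogeneousComponent_isHomogeneous i f)
  rw [mem_idealOfFunctional_iff p j hij (MvPolynomial.homogeneousComponent_isHomogeneous i f)]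
  rintro _ ⟨g, hg, rfl⟩
  -- Tested against a form g of degree j - i, the functional only sees the component of f in degree
  -- i.
  have h := hf g
  rw [pointFunctional_apply, mul_comm,
    homogeneousComponent_mul_of_isHomogeneous hg (Nat.sub_le j i), Nat.sub_sub_self hij] at h
  simpa [evalOn_mul, mul_comm] using h

theorem finite_quotient_idealOfFunctional :
    Module.Finite F (MvPolynomial (Fin r) F ⧸ idealOfFunctional (pointFunctional p j)) := by
  set I := idealOfFunctional (pointFunctional p j)
  let S : Submodule F (MvPolynomial (Fin r) F) :=
    ⨆ i : Fin (j + 1), MvPolynomial.homogeneousSubmodule (Fin r) F i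
  have hS : S.FG := Submodule.fg_iSup _ fun i => MvPolynomial.homogeneousSubmodule_fg _ _ _
  have htop : S.map (Ideal.Quotient.mkₐ F I).toLinearMap = ⊤ := by
    rw [eq_top_iff]
    rintro x -
    obtain ⟨f, rfl⟩ := Ideal.Quotient.mk_surjective x
    rw [← MvPolynomial.sum_homogeneousComponent f, map_sum]
    refine Submodule.sum_mem _ fun i _ => ?_
    rcases lt_or_ge j i with hij | hij
    · rw [Ideal.Quotient.eq_zero_iff_mem.mpr (mem_idealOfFunctional_of_lt p j hij
        (MvPolynomial.homogeneousComponent_isHomogeneous i f))]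
      exact Submodule.zero_mem _
    · exact ⟨_, Submodule.mem_iSup_of_mem (⟨i, by omega⟩ : Fin (j + 1))
        (MvPolynomial.homogeneousComponent_isHomogeneous i f), rfl⟩
  exact ⟨htop ▸ hS.map _⟩

theorem mk_mem_socle_iff (I : Ideal (MvPolynomial (Fin r) F)) (f : MvPolynomial (Fin r) F) :
    Ideal.Quotient.mk I f ∈ socle I ↔ ∀ m, f * MvPolynomial.X m ∈ I := by
  rw [socle, irrelevantIdeal, Submodule.mem_annihilator_span]
  simp [← map_mul, Ideal.Quotient.eq_zero_iff_mem]

theorem eq_C_add_sum_mul_X (g : MvPolynomial (Fin r) F) :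
    ∃ (c : F) (q : Fin r → MvPolynomial (Fin r) F),
      g = MvPolynomial.C c + ∑ m, MvPolynomial.X m * q m := by
  induction g using MvPolynomial.induction_on with
  | C a => exact ⟨a, 0, by simp⟩
  | add f g hf hg =>
    obtain ⟨c, q, rfl⟩ := hf
    obtain ⟨c', q', rfl⟩ := hg
    refine ⟨c + c', q + q', ?_⟩
    simp only [map_add, Pi.add_apply, mul_add, Finset.sum_add_distrib]
    ring
  | mul_X f m _ =>
    refine ⟨0, Pi.single m f, ?_⟩
    rw [Finset.sum_eq_single m] <;> simp +contextual [mul_comm]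

/-- φ restricts to an isomorphism from the socle to F. If f times each variable lies in I, then φ(f
g) = g(0) φ(f), so φ(f) = 0 forces f ∈ I. Conversely, forms of degree j have classes in the socle,
because forms of degree j + 1 lie in I. -/
theorem finrank_socle_idealOfFunctional (hφ : pointFunctional p j ≠ 0) :
    Module.finrank F (socle (idealOfFunctional (pointFunctional p j))) = 1 := by
  set φ := pointFunctional p j with hφdef
  set I := idealOfFunctional φ with hI
  have hle : I.restrictScalars F ≤ LinearMap.ker φ := fun f hf => by
    simpa using hf 1
  let ψ : (MvPolynomial (Fin r) F ⧸ I) →ₗ[F] F := (I.restrictScalars F).liftQ φ hle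
  have hψ : ∀ f, ψ (Ideal.Quotient.mk I f) = φ f := fun f => rfl
  let S : Submodule F (MvPolynomial (Fin r) F ⧸ I) := (socle I).restrictScalars F
  have hinj : Function.Injective (ψ.domRestrict S) := by
    rw [← LinearMap.ker_eq_bot, LinearMap.ker_eq_bot']
    rintro ⟨x, hx⟩ h0
    obtain ⟨f, rfl⟩ := Ideal.Quotient.mk_surjective x
    have h0 : φ f = 0 := h0
    have hx := (mk_mem_socle_iff I f).mp hx
    rw [Subtype.mk.injEq]
    refine Ideal.Quotient.eq_zero_iff_mem.mpr fun g => ?_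
    obtain ⟨c, q, rfl⟩ := eq_C_add_sum_mul_X g
    rw [mul_add, map_add, Finset.mul_sum, map_sum, mul_comm f, ← MvPolynomial.smul_eq_C_mul,
      map_smul, h0, smul_zero, zero_add]
    refine Finset.sum_eq_zero fun m _ => ?_
    rw [← mul_assoc]; exact hx m _
  have hsurj : Function.Surjective (ψ.domRestrict S) := by
    obtain ⟨g, hg⟩ : ∃ g, φ g ≠ 0 := by
      by_contra! h
      exact hφ (LinearMap.ext h)
    set f := MvPolynomial.homogeneousComponent j g
    have hf : f.IsHomogeneous j := MvPolynomial.homogeneousComponent_isHomogeneous j g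
    have hfg : φ f = φ g := by
      rw [hφdef, pointFunctional_apply, pointFunctional_apply,
        MvPolynomial.homogeneousComponent_eq_self hf]
    have hmem : Ideal.Quotient.mk I f ∈ S := (mk_mem_socle_iff I f).mpr fun m =>
      mem_idealOfFunctional_of_lt p j (Nat.lt_succ_self j) (hf.mul (MvPolynomial.isHomogeneous_X F m))
    refine LinearMap.surjective_of_ne_zero fun h => hg ?_
    rw [← hfg]
    exact LinearMap.congr_fun h ⟨_, hmem⟩
  exact (LinearEquiv.ofBijective _ ⟨hinj, hsurj⟩).finrank_eq.trans (Module.finrank_self F)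

theorem isGradedArtinianGorenstein_idealOfFunctional (hφ : pointFunctional p j ≠ 0) :
    IsGradedArtinianGorenstein (idealOfFunctional (pointFunctional p j)) := by
  have := finite_quotient_idealOfFunctional p j
  exact ⟨isHomogeneous_idealOfFunctional p j, IsArtinianRing.of_finite F _,
    finrank_socle_idealOfFunctional p j hφ⟩

/-! ### Hilbert function of the quotient -/

theorem finrank_map_eq_of_ker {V M N : Type*} [AddCommGroup V] [Module F V] [AddCommGroup M]
    [Module F M] [AddCommGroup N] [Module F N] (A : V →ₗ[F] M) (B : V →ₗ[F] N)
    (S : Submodule F V) (h : ∀ v ∈ S, A v = 0 ↔ B v = 0) :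
    Module.finrank F (S.map A) = Module.finrank F (S.map B) := by
  rw [← LinearMap.range_domRestrict, ← LinearMap.range_domRestrict]
  have hk : LinearMap.ker (A.domRestrict S) = LinearMap.ker (B.domRestrict S) := by
    ext ⟨v, hv⟩
    simpa using h v hv
  exact ((A.domRestrict S).quotKerEquivRange.symm.trans
    ((Submodule.quotEquivOfEq _ _ hk).trans (B.domRestrict S).quotKerEquivRange)).finrank_eq

theorem hilbertFn_idealOfFunctional_of_lt {i : ℕ} (hij : j < i) :
    hilbertFn (idealOfFunctional (pointFunctional p j)) i = 0 := by
  have h : (MvPolynomial.homogeneousSubmodule (Fin r) F i).map (Ideal.Quotient.mkₐ F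
      (idealOfFunctional (pointFunctional p j))).toLinearMap = ⊥ := by
    rw [Submodule.eq_bot_iff]
    rintro _ ⟨f, hf, rfl⟩
    exact Ideal.Quotient.eq_zero_iff_mem.mpr (mem_idealOfFunctional_of_lt p j hij hf)
  rw [hilbertFn, h, finrank_bot]

/-- A vector orthogonal to all of `Z → F` is zero, so in degree i the ideal consists of the forms
vanishing on the points. -/
theorem hilbertFn_idealOfFunctional_of_right {i : ℕ} (hij : i ≤ j)
    (h : formValues p (j - i) = ⊤) :
    hilbertFn (idealOfFunctional (pointFunctional p j)) i =
      Module.finrank F (formValues p i) := by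
  classical
  refine finrank_map_eq_of_ker _ _ _ fun f hf => ?_
  refine Ideal.Quotient.eq_zero_iff_mem.trans
    ((mem_idealOfFunctional_iff p j hij hf).trans ?_)
  rw [h]
  constructor
  · intro h'
    ext z
    simpa [Pi.single_apply] using h' (Pi.single z 1) trivial
  · intro h' w _
    simp only [h', Pi.zero_apply, zero_mul, Finset.sum_const_zero]

/-- Here the degree i part of the quotient is the dual of `formValues p (j - i)`: every functional
on that space is the pairing with some vector, and every vector is the value of a form of degree i.
-/
theorem hilbertFn_idealOfFunctional_of_left {i : ℕ} (hij : i ≤ j)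
    (h : formValues p i = ⊤) :
    hilbertFn (idealOfFunctional (pointFunctional p j)) i =
      Module.finrank F (formValues p (j - i)) := by
  classical
  let T : (Z → F) →ₗ[F] Module.Dual F (formValues p (j - i)) :=
    (formValues p (j - i)).dualRestrict ∘ₗ (dotProductEquiv F Z).toLinearMap
  have hT : Function.Surjective T :=
    (Subspace.dualRestrict_surjective).comp (dotProductEquiv F Z).surjective
  have key : hilbertFn (idealOfFunctional (pointFunctional p j)) i =
      Module.finrank F ((MvPolynomial.homogeneousSubmodule (Fin r) F i).map (T ∘ₗ evalOn p)) := by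
    refine finrank_map_eq_of_ker _ _ _ fun f hf => ?_
    refine Ideal.Quotient.eq_zero_iff_mem.trans
      ((mem_idealOfFunctional_iff p j hij hf).trans ?_)
    constructor
    · intro h'
      ext ⟨w, hw⟩
      exact h' w hw
    · intro h' w hw
      exact LinearMap.congr_fun h' ⟨w, hw⟩
  rw [key, Submodule.map_comp]
  change Module.finrank F ((formValues p i).map T) = _
  rw [h, Submodule.map_top, LinearMap.range_eq_top.mpr hT, finrank_top,
    Subspace.dual_finrank_eq]

end PointFunctional

/-! ### The Hilbert function of the points attached to a lower set of exponents -/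

section Newton

variable {F : Type*} [Field F] {m : ℕ} (t : ℕ → F) (D : Finset (Fin m → ℕ))

/-- The points `(1, t_{α 1}, …, t_{α m})` for `α ∈ D`. -/
def gridPoint (α : D) : Fin (m + 1) → F := Fin.cons 1 fun i => t (α.1 i)

/-- The values of the Newton polynomial with exponents `β` at the grid points of `D`. -/
def newtonFn (β : Fin m → ℕ) (α : D) : F := ∏ i, ∏ c ∈ range (β i), (t (α.1 i) - t c)

/-- The form of degree `n` in `m + 1` variables that restricts to the Newton polynomial `β`. -/
noncomputable def newtonForm (β : Fin m → ℕ) (n : ℕ) : MvPolynomial (Fin (m + 1)) F :=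
  MvPolynomial.X 0 ^ (n - ∑ i, β i) *
    ∏ i, ∏ c ∈ range (β i), (MvPolynomial.X i.succ - MvPolynomial.C (t c) * MvPolynomial.X 0)

theorem isHomogeneous_newtonForm {β : Fin m → ℕ} {n : ℕ} (h : ∑ i, β i ≤ n) :
    (newtonForm t β n).IsHomogeneous n := by
  have h1 : ∀ i, (∏ c ∈ range (β i), (MvPolynomial.X i.succ -
      MvPolynomial.C (t c) * MvPolynomial.X 0) : MvPolynomial (Fin (m + 1)) F).IsHomogeneous
        (β i) := by
    intro i
    have := MvPolynomial.IsHomogeneous.prod (range (β i)) (fun c => (MvPolynomial.X i.succ -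
      MvPolynomial.C (t c) * MvPolynomial.X 0 : MvPolynomial (Fin (m + 1)) F)) (fun _ => 1)
      fun c _ => (MvPolynomial.isHomogeneous_X F i.succ).sub
        (MvPolynomial.isHomogeneous_C_mul_X (t c) 0)
    simpa using this
  have h2 := MvPolynomial.IsHomogeneous.prod univ _ β fun i _ => h1 i
  have h3 := (MvPolynomial.isHomogeneous_X_pow (R := F) (0 : Fin (m + 1)) (n - ∑ i, β i)).mul h2
  rwa [Nat.sub_add_cancel h] at h3

theorem evalOn_newtonForm (β : Fin m → ℕ) (n : ℕ) :
    evalOn (gridPoint t D) (newtonForm t β n) = newtonFn t D β := by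
  ext α
  simp [newtonForm, newtonFn, gridPoint, map_prod]

variable {t D}

/-- Triangularity: if α i < β i, the factor with c = α i occurs in the product and vanishes at α. -/
theorem newtonFn_eq_zero {β : Fin m → ℕ} {α : D} (h : ¬ β ≤ α.1) : newtonFn t D β α = 0 := by
  obtain ⟨i, hi⟩ := not_forall.mp h
  exact Finset.prod_eq_zero (mem_univ i)
    (Finset.prod_eq_zero (Finset.mem_range.mpr (not_le.mp hi)) (sub_self _))

theorem newtonFn_self_ne_zero (ht : Function.Injective t) (α : D) : newtonFn t D α.1 α ≠ 0 := by
  refine Finset.prod_ne_zero_iff.mpr fun i _ => Finset.prod_ne_zero_iff.mpr fun c hc => ?_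
  rw [sub_ne_zero]
  exact fun h => (Finset.mem_range.mp hc).ne' (ht h)

theorem linearIndependent_newtonFn (ht : Function.Injective t) :
    LinearIndependent F fun β : D => newtonFn t D β.1 := by
  rw [Fintype.linearIndependent_iff]
  intro g hg
  classical
  by_contra! hne
  -- At a minimal exponent β of the relation, every other term vanishes by triangularity.
  obtain ⟨β, hβ, hmin⟩ := (univ.filter fun β : D => g β ≠ 0).exists_minimal
    (by obtain ⟨i, hi⟩ := hne; exact ⟨i, by simpa using hi⟩)
  simp only [mem_filter, mem_univ, true_and] at hβ hmin
  have h := congrFun hg β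
  rw [Finset.sum_apply, Finset.sum_eq_single β] at h
  · exact mul_ne_zero hβ (newtonFn_self_ne_zero ht β) h
  · intro γ _ hγ
    by_cases h0 : g γ = 0
    · simp [h0]
    · have : ¬ γ.1 ≤ β.1 := fun hle => hγ (le_antisymm hle (hmin h0 hle))
      simp [newtonFn_eq_zero this]
  · simp

variable (t D)

/-- The Newton recursion: multiplying by a coordinate raises the degree by at most one. This drives
the induction in `evalOn_mem_span_newtonFn`. -/
theorem coord_mul_newtonFn (β : Fin m → ℕ) (i : Fin m) :
    (fun α : D => t (α.1 i)) * newtonFn t D β =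
      newtonFn t D (Function.update β i (β i + 1)) + t (β i) • newtonFn t D β := by
  have hs : ∀ α : D, newtonFn t D (Function.update β i (β i + 1)) α =
      (t (α.1 i) - t (β i)) * newtonFn t D β α := by
    intro α
    unfold newtonFn
    rw [← Finset.mul_prod_erase univ _ (mem_univ i),
      ← Finset.mul_prod_erase univ (fun i => ∏ c ∈ range (β i), (t (α.1 i) - t c)) (mem_univ i),
      Function.update_self, Finset.prod_range_succ]
    rw [Finset.prod_congr rfl (g := fun l => ∏ c ∈ range (β l), (t (α.1 l) - t c))]
    · ring
    · intro l hl
      rw [Function.update_of_ne (Finset.ne_of_mem_erase hl)]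
  ext α
  simp only [Pi.mul_apply, Pi.add_apply, hs, Pi.smul_apply, smul_eq_mul]
  ring

theorem coord_mul_mem_span {n : ℕ} (v : Fin (m + 1)) {w : D → F}
    (hw : w ∈ Submodule.span F (newtonFn t D '' {β | ∑ i, β i ≤ n})) :
    evalOn (gridPoint t D) (MvPolynomial.X v) * w ∈
      Submodule.span F (newtonFn t D '' {β | ∑ i, β i ≤ n + 1}) := by
  induction hw using Submodule.span_induction with
  | zero => simp
  | add x y _ _ hx hy => rw [mul_add]; exact Submodule.add_mem _ hx hy
  | smul c x _ hx => rw [mul_smul_comm]; exact Submodule.smul_mem _ c hx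
  | mem x hx =>
    obtain ⟨β, hβ, rfl⟩ := hx
    have hβ : ∑ i, β i ≤ n := hβ
    refine Fin.cases ?_ (fun i => ?_) v
    · have : evalOn (gridPoint t D) (MvPolynomial.X (0 : Fin (m + 1))) = 1 := by
        ext α; simp [gridPoint]
      rw [this, one_mul]
      exact Submodule.subset_span ⟨β, Nat.le_succ_of_le hβ, rfl⟩
    · have : evalOn (gridPoint t D) (MvPolynomial.X i.succ) = fun α : D => t (α.1 i) := by
        ext α; simp [gridPoint]
      rw [this, coord_mul_newtonFn]
      refine Submodule.add_mem _ (Submodule.subset_span ⟨_, ?_, rfl⟩)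
        (Submodule.smul_mem _ _ (Submodule.subset_span ⟨β, Nat.le_succ_of_le hβ, rfl⟩))
      change ∑ l, Function.update β i (β i + 1) l ≤ n + 1
      have h1 : β i + ∑ l ∈ univ.erase i, β l = ∑ l, β l := Finset.add_sum_erase _ _ (mem_univ i)
      rw [← Finset.add_sum_erase univ _ (mem_univ i), Function.update_self,
        Finset.sum_congr rfl fun l hl => Function.update_of_ne (Finset.ne_of_mem_erase hl) _ β]
      change _ + ∑ l ∈ univ.erase i, β l ≤ _
      omega

theorem evalOn_mem_span_newtonFn (n : ℕ) (f : MvPolynomial (Fin (m + 1)) F)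
    (hf : f ∈ MvPolynomial.homogeneousSubmodule (Fin (m + 1)) F n) :
    evalOn (gridPoint t D) f ∈ Submodule.span F (newtonFn t D '' {β | ∑ i, β i ≤ n}) := by
  induction n generalizing f with
  | zero =>
    rw [MvPolynomial.homogeneousSubmodule_zero, Submodule.mem_one] at hf
    obtain ⟨c, rfl⟩ := hf
    have : evalOn (gridPoint t D) (algebraMap F (MvPolynomial (Fin (m + 1)) F) c) =
        c • newtonFn t D 0 := by
      ext α; simp [newtonFn]
    rw [this]
    exact Submodule.smul_mem _ _ (Submodule.subset_span ⟨0, by simp, rfl⟩)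
  | succ n ih =>
    rw [← MvPolynomial.homogeneousSubmodule_one_pow, pow_succ,
      MvPolynomial.homogeneousSubmodule_one_pow] at hf
    induction hf using Submodule.mul_induction_on' with
    | add x _ y _ hx hy => rw [map_add]; exact Submodule.add_mem _ hx hy
    | mem_mul_mem a ha b hb =>
      rw [MvPolynomial.homogeneousSubmodule_one_eq_span_X] at hb
      induction hb using Submodule.span_induction with
      | zero => simp
      | add x y _ _ hx hy => rw [mul_add, map_add]; exact Submodule.add_mem _ hx hy
      | smul c x _ hx => rw [mul_smul_comm, map_smul]; exact Submodule.smul_mem _ c hx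
      | mem x hx =>
        obtain ⟨v, rfl⟩ := hx
        rw [evalOn_mul, mul_comm]
        exact coord_mul_mem_span t D v (ih a ha)

variable {D}

/-- An exponent outside the lower set D lies below no element of D, so its Newton function vanishes
at every grid point and can be dropped. -/
theorem formValues_gridPoint (hD : IsLowerSet (D : Set (Fin m → ℕ))) (n : ℕ) :
    formValues (gridPoint t D) n =
      Submodule.span F (Set.range fun β : {β : D // ∑ i, β.1 i ≤ n} => newtonFn t D β.1.1) := by
  apply le_antisymm
  · rintro _ ⟨f, hf, rfl⟩
    refine Submodule.span_le.mpr ?_ (evalOn_mem_span_newtonFn t D n f hf)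
    rintro _ ⟨β, hβ, rfl⟩
    by_cases hmem : β ∈ D
    · exact Submodule.subset_span ⟨⟨⟨β, hmem⟩, hβ⟩, rfl⟩
    · have : newtonFn t D β = 0 := by
        ext α
        exact newtonFn_eq_zero fun hle => hmem (hD hle α.2)
      rw [this]
      exact Submodule.zero_mem _
  · rw [Submodule.span_le]
    rintro _ ⟨β, rfl⟩
    exact ⟨newtonForm t β.1.1 n, isHomogeneous_newtonForm t β.2, evalOn_newtonForm t D _ n⟩

variable {t}

theorem finrank_formValues_gridPoint (ht : Function.Injective t)
    (hD : IsLowerSet (D : Set (Fin m → ℕ))) (n : ℕ) :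
    Module.finrank F (formValues (gridPoint t D) n) = #{β ∈ D | ∑ i, β i ≤ n} := by
  classical
  have hli : LinearIndependent F fun β : {β : D // ∑ i, β.1 i ≤ n} => newtonFn t D β.1.1 :=
    (linearIndependent_newtonFn ht).comp _ Subtype.val_injective
  rw [formValues_gridPoint t hD, finrank_span_eq_card hli, Fintype.card_subtype]
  rw [← Finset.card_map (Function.Embedding.subtype _)]
  congr 1
  ext β
  simp [and_comm]

theorem formValues_gridPoint_eq_top (ht : Function.Injective t)
    (hD : IsLowerSet (D : Set (Fin m → ℕ))) {n : ℕ} (hn : ∀ β ∈ D, ∑ i, β i ≤ n) :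
    formValues (gridPoint t D) n = ⊤ := by
  apply Submodule.eq_top_of_finrank_eq
  rw [finrank_formValues_gridPoint ht hD, Finset.filter_true_of_mem hn, Module.finrank_pi,
    Fintype.card_coe]

/-- A finite lower set of exponents of degrees at most `τ` gives, for each `j ≥ 2 τ`, a graded
Artinian Gorenstein algebra whose Hilbert function is the symmetrization of the counting function
of the lower set. -/
theorem exists_gorenstein_of_isLowerSet (F : Type*) [Field F] [Infinite F]
    (hD : IsLowerSet (D : Set (Fin m → ℕ))) (hne : D.Nonempty) {τ j : ℕ}
    (hτ : ∀ β ∈ D, ∑ i, β i ≤ τ) (hj : 2 * τ ≤ j) :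
    ∃ I : Ideal (MvPolynomial (Fin (m + 1)) F), IsGradedArtinianGorenstein I ∧
      ∀ i, hilbertFn I i = if i ≤ j then #{β ∈ D | ∑ l, β l ≤ min i (j - i)} else 0 := by
  let t : ℕ → F := Infinite.natEmbedding F
  have ht : Function.Injective t := (Infinite.natEmbedding F).injective
  have htop : ∀ n, τ ≤ n → formValues (gridPoint t D) n = ⊤ := fun n hn =>
    formValues_gridPoint_eq_top ht hD fun β hβ => (hτ β hβ).trans hn
  refine ⟨idealOfFunctional (pointFunctional (gridPoint t D) j),
    isGradedArtinianGorenstein_idealOfFunctional _ _ fun h0 => ?_, fun i => ?_⟩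
  -- A form of degree j whose values are the indicator of a single point has φ-value 1.
  · classical
    obtain ⟨β, hβ⟩ := hne
    obtain ⟨f, hf, hfβ⟩ : Pi.single ⟨β, hβ⟩ 1 ∈ formValues (gridPoint t D) j := by
      rw [htop j (by omega)]; trivial
    have := LinearMap.congr_fun h0 f
    rw [pointFunctional_apply, MvPolynomial.homogeneousComponent_eq_self hf, hfβ] at this
    simp [Pi.single_apply] at this
  · split_ifs with hij
    -- As j ≥ 2τ, either j - i ≥ τ or i ≥ τ, so at least one of the two degrees takes all values on
    -- the points.
    · rcases le_total i τ with hi | hi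
      · rw [hilbertFn_idealOfFunctional_of_right _ _ hij (htop _ (by omega)),
          finrank_formValues_gridPoint ht hD, min_eq_left (by omega)]
      · rw [hilbertFn_idealOfFunctional_of_left _ _ hij (htop _ hi),
          finrank_formValues_gridPoint ht hD]
        congr 1
        -- If i < j - i, both cutoffs are at least τ and neither excludes any β.
        refine Finset.filter_congr fun β hβ => ?_
        have := hτ β hβ
        omega
    · exact hilbertFn_idealOfFunctional_of_lt _ _ (not_le.mp hij)

end Newton

/-! ### A lower set of exponents for each triple -/

/-- The pairs `(y, z)` with `y + z ≤ a` and `z < δ`. -/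
def slab (a δ : ℕ) : Finset (ℕ × ℕ) := {q ∈ range (a + 1) ×ˢ range δ | q.1 + q.2 ≤ a}

theorem mem_slab {a δ : ℕ} {q : ℕ × ℕ} : q ∈ slab a δ ↔ q.1 + q.2 ≤ a ∧ q.2 < δ := by
  simp only [slab, mem_filter, mem_product, Finset.mem_range]
  omega

theorem card_slab (a δ : ℕ) : #(slab a δ) = ∑ z ∈ range δ, (a + 1 - z) := by
  rw [Finset.card_eq_sum_card_fiberwise (f := Prod.snd) (t := range δ)
    fun q hq => Finset.mem_range.mpr (mem_slab.mp hq).2]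
  refine Finset.sum_congr rfl fun z hz => ?_
  rw [← Finset.card_range (a + 1 - z)]
  refine Finset.card_nbij' Prod.fst (fun y => (y, z)) ?_ ?_ ?_ ?_
  · rintro ⟨y, w⟩ h
    rw [mem_coe, mem_filter, mem_slab] at h
    rw [coe_range, Set.mem_Iio]
    simp only at h ⊢
    omega
  · intro y h
    rw [coe_range, Set.mem_Iio] at h
    rw [mem_coe, mem_filter, mem_slab]
    refine ⟨⟨?_, Finset.mem_range.mp hz⟩, rfl⟩
    change y + z ≤ a
    omega
  · rintro ⟨y, w⟩ h
    rw [mem_coe, mem_filter] at h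
    rw [← h.2]
  · intro y _
    rfl

theorem sum_range_sub_eq_choose (a : ℕ) : ∑ z ∈ range (a + 1), (a + 1 - z) = (a + 2).choose 2 := by
  rw [← Finset.sum_range_reflect]
  have : ∀ z ∈ range (a + 1), a + 1 - (a + 1 - 1 - z) = z + 1 := by
    intro z hz
    rw [Finset.mem_range] at hz
    omega
  rw [Finset.sum_congr rfl this]
  induction a with
  | zero => rfl
  | succ a ih =>
    rw [Finset.sum_range_succ, ih (by intro z hz; rw [Finset.mem_range] at hz; omega),
      Nat.choose_succ_succ' (a + 2) 1, Nat.choose_one_right, add_comm]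

theorem isLowerSet_slab (a δ : ℕ) : IsLowerSet (slab a δ : Set (ℕ × ℕ)) := by
  intro q q' hle hq
  rw [mem_coe, mem_slab] at hq ⊢
  have h1 := hle.1
  have h2 := hle.2
  omega

/-- Between two finite lower sets there are lower sets of all intermediate cardinalities. -/
theorem exists_isLowerSet_card {α : Type*} [PartialOrder α] [DecidableEq α] {S T : Finset α}
    (hS : IsLowerSet (S : Set α)) (hT : IsLowerSet (T : Set α)) (hST : S ⊆ T) {n : ℕ}
    (hn : #S ≤ n) (hn' : n ≤ #T) :
    ∃ B : Finset α, IsLowerSet (B : Set α) ∧ S ⊆ B ∧ B ⊆ T ∧ #B = n := by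
  induction h : #T - n generalizing T with
  | zero => exact ⟨T, hT, hST, subset_rfl, by omega⟩
  | succ e ih =>
    have hne : (T \ S).Nonempty := by
      rw [← Finset.card_pos, Finset.card_sdiff_of_subset hST]
      omega
    -- Erasing an element maximal in T \ S keeps T lower: an element of T strictly above x would lie
    -- in S, and then so would x.
    obtain ⟨x, hx, hmax⟩ := (T \ S).exists_maximal hne
    rw [mem_sdiff] at hx
    have hcard := Finset.card_erase_of_mem hx.1
    have hlow : IsLowerSet (T.erase x : Set α) := by
      intro u v hvu hu
      rw [mem_coe, mem_erase] at hu ⊢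
      refine ⟨?_, hT hvu hu.2⟩
      rintro rfl
      have huS : u ∉ S := fun huS => hx.2 (hS hvu huS)
      exact hu.1 (le_antisymm (hmax (mem_sdiff.mpr ⟨hu.2, huS⟩) hvu) hvu)
    obtain ⟨B, h1, h2, h3, h4⟩ := ih hlow
      (fun y hy => mem_erase.mpr ⟨fun hyx => hx.2 (hyx ▸ hy), hST hy⟩) (by omega) (by omega)
    exact ⟨B, h1, h2, h3.trans (erase_subset _ _), h4⟩

/-- The exponents of all monomials of degree at most `k`, of those monomials `x^u y^v z^w` of
degrees `k + 1` and `k + 2` with `(v, w) ∈ B`, and of `y^v z^w` with `v + w = k + 2`, `w < δ`. -/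
def tripleExponents (δ k : ℕ) (B : Finset (ℕ × ℕ)) : Finset (Fin 3 → ℕ) :=
  {α ∈ Fintype.piFinset fun _ => range (k + 3) |
    α 0 + α 1 + α 2 ≤ k ∨ α 0 + α 1 + α 2 = k + 1 ∧ (α 1, α 2) ∈ B ∨
      α 0 + α 1 + α 2 = k + 2 ∧ ((α 1, α 2) ∈ B ∨ α 0 = 0 ∧ α 2 < δ)}

theorem mem_tripleExponents {δ k : ℕ} {B : Finset (ℕ × ℕ)} {α : Fin 3 → ℕ} :
    α ∈ tripleExponents δ k B ↔
      α 0 + α 1 + α 2 ≤ k ∨ α 0 + α 1 + α 2 = k + 1 ∧ (α 1, α 2) ∈ B ∨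
      α 0 + α 1 + α 2 = k + 2 ∧ ((α 1, α 2) ∈ B ∨ α 0 = 0 ∧ α 2 < δ) := by
  rw [tripleExponents, mem_filter, and_iff_right_iff_imp, Fintype.mem_piFinset]
  intro h i
  rw [Finset.mem_range]
  fin_cases i <;> simp <;> omega

section TripleExponents

variable {δ k : ℕ} {B : Finset (ℕ × ℕ)}

/-- The only delicate divisors are those of degree k + 1 of the extra monomials y^v z^w: they
satisfy v + w = k + 1 and w < δ, hence lie in the slab. -/
theorem isLowerSet_tripleExponents (hB : IsLowerSet (B : Set (ℕ × ℕ)))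
    (hδB : slab (k + 1) δ ⊆ B) : IsLowerSet (tripleExponents δ k B : Set (Fin 3 → ℕ)) := by
  intro β α hle hβ
  rw [mem_coe, mem_tripleExponents] at hβ ⊢
  have h0 : α 0 ≤ β 0 := hle 0
  have h1 : α 1 ≤ β 1 := hle 1
  have h2 : α 2 ≤ β 2 := hle 2
  have hlow : (β 1, β 2) ∈ B → (α 1, α 2) ∈ B := fun h => hB (Prod.mk_le_mk.mpr ⟨h1, h2⟩) h
  have hslab : α 1 + α 2 ≤ k + 1 → α 2 < δ → (α 1, α 2) ∈ B := fun h h' =>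
    hδB (mem_slab.mpr ⟨h, h'⟩)
  by_cases hk : α 0 + α 1 + α 2 ≤ k
  · exact Or.inl hk
  rcases hβ with h | ⟨h, hb⟩ | ⟨h, hb | ⟨hb0, hb⟩⟩
  · omega
  · exact Or.inr (Or.inl ⟨by omega, hlow hb⟩)
  · by_cases hα : α 0 + α 1 + α 2 = k + 1
    · exact Or.inr (Or.inl ⟨hα, hlow hb⟩)
    · exact Or.inr (Or.inr ⟨by omega, Or.inl (hlow hb)⟩)
  · by_cases hα : α 0 + α 1 + α 2 = k + 1
    · exact Or.inr (Or.inl ⟨hα, hslab (by omega) (by omega)⟩)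
    · exact Or.inr (Or.inr ⟨by omega, Or.inr ⟨by omega, by omega⟩⟩)

/-- A layer of fixed degree is counted after forgetting the first exponent, which the degree
restores; the bound on q.1 + q.2 guards the truncated subtraction. -/
theorem card_degree_eq {D : Finset (Fin 3 → ℕ)} {d : ℕ} {E : Finset (ℕ × ℕ)}
    (hE : ∀ q : ℕ × ℕ, q ∈ E ↔ q.1 + q.2 ≤ d ∧ ![d - q.1 - q.2, q.1, q.2] ∈ D) :
    #{α ∈ D | ∑ i, α i = d} = #E := by
  have key : ∀ α : Fin 3 → ℕ, ∑ i, α i = d → ![d - α 1 - α 2, α 1, α 2] = α := by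
    intro α h
    rw [Fin.sum_univ_three] at h
    ext i
    fin_cases i
    · simp; omega
    · rfl
    · rfl
  refine Finset.card_nbij' (fun α => (α 1, α 2)) (fun q => ![d - q.1 - q.2, q.1, q.2]) ?_ ?_ ?_ ?_
  · intro α h
    rw [mem_coe, mem_filter] at h
    rw [mem_coe, hE, key α h.2]
    refine ⟨?_, h.1⟩
    have := h.2
    rw [Fin.sum_univ_three] at this
    change α 1 + α 2 ≤ d
    omega
  · intro q h
    rw [mem_coe, hE] at h
    rw [mem_coe, mem_filter, Fin.sum_univ_three]
    refine ⟨h.2, ?_⟩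
    change d - q.1 - q.2 + q.1 + q.2 = d
    omega
  · intro α h
    rw [mem_coe, mem_filter] at h
    exact key α h.2
  · intro q _
    rfl

theorem card_degree_tripleExponents_of_le {d : ℕ} (hd : d ≤ k) :
    #{α ∈ tripleExponents δ k B | ∑ i, α i = d} = (d + 2).choose 2 := by
  rw [← sum_range_sub_eq_choose, ← card_slab]
  apply card_degree_eq
  rintro ⟨y, z⟩
  rw [mem_slab, mem_tripleExponents]
  simp only [Matrix.cons_val]
  constructor
  · intro h
    exact ⟨h.1, Or.inl (by omega)⟩
  · intro h
    exact ⟨h.1, by omega⟩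

theorem card_degree_tripleExponents_succ (hBk : B ⊆ slab (k + 1) (k + 2)) :
    #{α ∈ tripleExponents δ k B | ∑ i, α i = k + 1} = #B := by
  apply card_degree_eq
  rintro ⟨y, z⟩
  rw [mem_tripleExponents]
  simp only [Matrix.cons_val]
  constructor
  · intro h
    have h' := (mem_slab.mp (hBk h)).1
    exact ⟨h', Or.inr (Or.inl ⟨by simp only at h'; omega, h⟩)⟩
  · rintro ⟨h, h' | h' | h'⟩
    · omega
    · exact h'.2
    · omega

/-- The δ extra pairs lie on the line y + z = k + 2, just outside the triangle that contains B. -/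
theorem card_degree_tripleExponents_add_two (hBk : B ⊆ slab (k + 1) (k + 2)) (hδ : δ ≤ k + 1) :
    #{α ∈ tripleExponents δ k B | ∑ i, α i = k + 2} = #B + δ := by
  classical
  have hinj : Function.Injective fun z : ℕ => (k + 2 - z, z) := fun z w h => (Prod.ext_iff.mp h).2
  have hcard : #(B ∪ (range δ).image fun z => (k + 2 - z, z)) = #B + δ := by
    rw [Finset.card_union_of_disjoint, Finset.card_image_of_injective _ hinj, Finset.card_range]
    rw [Finset.disjoint_left]
    intro q hq hq'
    obtain ⟨z, hz, rfl⟩ := Finset.mem_image.mp hq'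
    have h' := (mem_slab.mp (hBk hq)).1
    simp only at h'
    omega
  rw [← hcard]
  apply card_degree_eq
  rintro ⟨y, z⟩
  rw [mem_tripleExponents, mem_union, mem_image]
  simp only [Matrix.cons_val, Finset.mem_range, Prod.mk.injEq]
  constructor
  · rintro (h | ⟨w, hw, rfl, rfl⟩)
    · have h' := (mem_slab.mp (hBk h)).1
      simp only at h'
      exact ⟨by omega, Or.inr (Or.inr ⟨by omega, Or.inl h⟩)⟩
    · exact ⟨by omega, Or.inr (Or.inr ⟨by omega, Or.inr ⟨by omega, hw⟩⟩)⟩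
  · rintro ⟨h, h' | h' | ⟨-, h' | h'⟩⟩
    · omega
    · omega
    · exact Or.inl h'
    · exact Or.inr ⟨z, h'.2, by omega, rfl⟩

theorem card_degree_le_succ (D : Finset (Fin 3 → ℕ)) (n : ℕ) :
    #{α ∈ D | ∑ i, α i ≤ n + 1} = #{α ∈ D | ∑ i, α i ≤ n} + #{α ∈ D | ∑ i, α i = n + 1} := by
  rw [← Finset.card_union_of_disjoint]
  · congr 1
    ext α
    simp only [mem_filter, mem_union, ← and_or_left]
    rw [Nat.le_succ_iff]
  · rw [Finset.disjoint_left]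
    intro α h h'
    rw [mem_filter] at h h'
    omega

theorem card_degree_le_tripleExponents {n : ℕ} (hn : n ≤ k) :
    #{α ∈ tripleExponents δ k B | ∑ i, α i ≤ n} = sdim n := by
  induction n with
  | zero =>
    simp only [Nat.le_zero]
    rw [card_degree_tripleExponents_of_le hn]
    rfl
  | succ n ih =>
    rw [card_degree_le_succ, ih (by omega), card_degree_tripleExponents_of_le hn, sdim, sdim,
      Nat.choose_succ_succ' (n + 3) 2, add_comm]

end TripleExponents

theorem sdim_one : sdim 1 = 4 := rfl

/-- The two bounds on b are the cardinalities of `slab (k + 1) δ` and of the full triangle `slab (k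
+ 1) (k + 2)`, so a lower set B with b elements fits between them. -/
theorem isGorensteinSequence_tripleSeq (F : Type*) [Field F] [Infinite F] {δ k b : ℕ} (hk : 1 ≤ k)
    (hδ : δ ≤ k + 1) (hb : ∑ z ∈ range δ, (k + 2 - z) ≤ b) (hb' : b ≤ (k + 3).choose 2) :
    IsGorensteinSequence F 4 (tripleSeq δ k b) := by
  obtain ⟨B, hB, hδB, hBk, hcard⟩ := exists_isLowerSet_card (isLowerSet_slab (k + 1) δ)
    (isLowerSet_slab (k + 1) (k + 2))
    (fun q hq => by rw [mem_slab] at hq ⊢; omega) (n := b)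
    (by rwa [card_slab]) (by rwa [card_slab, sum_range_sub_eq_choose])
  set D := tripleExponents δ k B
  have h0 : ∀ n ≤ k, #{α ∈ D | ∑ i, α i ≤ n} = sdim n := fun n hn =>
    card_degree_le_tripleExponents hn
  have h1 : #{α ∈ D | ∑ i, α i ≤ k + 1} = sdim k + b := by
    rw [card_degree_le_succ, h0 k le_rfl, card_degree_tripleExponents_succ hBk, hcard]
  have h2 : #{α ∈ D | ∑ i, α i ≤ k + 2} = sdim k + 2 * b + δ := by
    rw [card_degree_le_succ, h1, card_degree_tripleExponents_add_two hBk hδ, hcard]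
    ring
  obtain ⟨I, hI, hH⟩ := exists_gorenstein_of_isLowerSet F (isLowerSet_tripleExponents hB hδB)
    ⟨0, mem_tripleExponents.mpr (Or.inl (by simp))⟩ (τ := k + 2) (j := 2 * k + 4)
    (fun α hα => by
      rw [mem_tripleExponents] at hα
      rw [Fin.sum_univ_three]
      omega) (by omega)
  refine ⟨?_, I, hI, fun i => ?_⟩
  · rw [tripleSeq, if_pos hk, sdim_one]
  · rw [hH i, tripleSeq]
    split_ifs with hj hik hi1 hi2 hi3
    · rw [min_eq_left (by omega), h0 i hik]
    · rw [min_eq_left (by omega), hi1, h1]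
    · rw [min_eq_left (by omega), hi2, h2]
    · rw [min_eq_right (by omega), show 2 * k + 4 - i = k + 1 by omega, h1]
    · rw [min_eq_right (by omega), h0 _ (by omega)]
    all_goals first | rfl | omega

/-! ### Macaulay expansions -/

theorem sum_Icc_one_succ {M : Type*} [AddCommMonoid M] (a : ℕ) (f : ℕ → M) :
    ∑ i ∈ Icc 1 (a + 1), f i = ∑ i ∈ Icc 1 a, f i + f (a + 1) :=
  Finset.sum_Icc_succ_top (Nat.le_add_left 1 a) f

theorem exists_expansion_choose {a : ℕ} (ha : 1 ≤ a) :
    ∃ n : ℕ → ℕ, IsMacaulayExpansion a ((a + 2).choose 2 : ℕ) n ∧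
      ∑ i ∈ Icc 1 a, (n i + 1).choose (i + 1) = (a + 3).choose 2 := by
  -- The expansion is the single term C(a+2, a); the entries i - 1 are fillers with C(i-1, i) = 0.
  refine ⟨fun i => if i = a then a + 2 else i - 1, ⟨fun i hi hia => ?_, ?_⟩, ?_⟩
  · simp only
    split_ifs <;> omega
  · rw [Finset.sum_eq_single_of_mem a (Finset.mem_Icc.mpr ⟨ha, le_rfl⟩)]
    · simp only [if_true]
      rw [Nat.choose_symm_add]
    · intro i hi hne
      simp only [if_neg hne]
      exact Nat.choose_eq_zero_of_lt (by have := (Finset.mem_Icc.mp hi).1; omega)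
  · rw [Finset.sum_eq_single_of_mem a (Finset.mem_Icc.mpr ⟨ha, le_rfl⟩)]
    · simp only [if_true]
      exact Nat.choose_symm_of_eq_add (by omega)
    · intro i hi hne
      simp only [if_neg hne]
      exact Nat.choose_eq_zero_of_lt (by have := (Finset.mem_Icc.mp hi).1; omega)

/-- For `b < C(a + 2, 2)` the Macaulay expansion of `b` in degree `a` has growth at least `δ`
as soon as `b` is at least `(a + 1) + a + ⋯` (`δ` summands). -/
theorem exists_expansion_growth (a b δ : ℕ) (hb : b < (a + 2).choose 2)
    (hδ : ∑ z ∈ range δ, (a + 1 - z) ≤ b) :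
    ∃ n : ℕ → ℕ, n a ≤ a + 1 ∧ (∀ i, 1 ≤ i → i < a → n i < n (i + 1)) ∧
      ∑ i ∈ Icc 1 a, (n i).choose i = b ∧
      b + δ ≤ ∑ i ∈ Icc 1 a, (n i + 1).choose (i + 1) := by
  induction a generalizing b δ with
  | zero =>
    have hb0 : b = 0 := by simpa using hb
    rcases δ with _ | δ
    · exact ⟨fun _ => 0, by simp, by simp, by simp [hb0], by simp [hb0]⟩
    · rw [Finset.sum_range_succ'] at hδ
      omega
  | succ a ih =>
    rcases Nat.lt_or_ge b (a + 2) with hlt | hge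
    · have hδ0 : δ = 0 := by
        rcases δ with _ | δ
        · rfl
        · rw [Finset.sum_range_succ'] at hδ
          omega
      have hcount : ∑ i ∈ Icc 1 (a + 1), (if a + 1 - b < i then 1 else 0) = b := by
        rw [← Finset.card_filter]
        have : {i ∈ Icc 1 (a + 1) | a + 1 - b < i} = Ioc (a + 1 - b) (a + 1) := by
          ext i
          simp only [mem_filter, Finset.mem_Icc, Finset.mem_Ioc]
          omega
        rw [this, Nat.card_Ioc]
        omega
      -- For b ≤ a + 1 the expansion is b terms C(i, i) = 1 at the top indices, with no growth.
      refine ⟨fun i => if a + 1 - b < i then i else i - 1, ?_, ?_, ?_, ?_⟩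
      · simp only
        split_ifs <;> omega
      · intro i _ _
        simp only
        split_ifs <;> omega
      · refine (Finset.sum_congr rfl fun i hi => ?_).trans hcount
        have := (Finset.mem_Icc.mp hi).1
        simp only
        split_ifs
        · exact Nat.choose_self i
        · exact Nat.choose_eq_zero_of_lt (by omega)
      · rw [hδ0, add_zero]
        refine (hcount.symm.trans (Finset.sum_congr rfl fun i hi => ?_)).le
        have := (Finset.mem_Icc.mp hi).1
        simp only
        split_ifs
        · exact (Nat.choose_self (i + 1)).symm
        · exact (Nat.choose_eq_zero_of_lt (by omega)).symm
    -- Otherwise split off the leading term C(a+2, a+1) = a + 2. It grows to a + 3, which accounts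
    -- for one unit of δ; the invariant `n a ≤ a + 1` keeps the expansion strict.
    · have hb' : b - (a + 2) < (a + 2).choose 2 := by
        rw [Nat.choose_succ_succ' (a + 2) 1, Nat.choose_one_right] at hb
        simp only [Nat.reduceAdd] at hb
        omega
      have hδ' : ∑ z ∈ range (δ - 1), (a + 1 - z) ≤ b - (a + 2) := by
        rcases δ with _ | δ
        · simp
        · rw [Finset.sum_range_succ'] at hδ
          simp only [Nat.add_sub_cancel]
          rw [Finset.sum_congr rfl fun z _ => show a + 1 - z = a + 1 + 1 - (z + 1) by omega]
          omega
      obtain ⟨n, hna, hmono, hsum, hgrow⟩ := ih (b - (a + 2)) (δ - 1) hb' hδ'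
      have hne : ∀ i ∈ Icc 1 a, Function.update n (a + 1) (a + 2) i = n i := by
        intro i hi
        rw [Function.update_of_ne]
        have := (Finset.mem_Icc.mp hi).2
        omega
      refine ⟨Function.update n (a + 1) (a + 2), by simp, ?_, ?_, ?_⟩
      · intro i hi hia
        rw [Function.update_of_ne (by omega)]
        rcases Nat.lt_or_ge i a with h | h
        · rw [Function.update_of_ne (by omega)]
          exact hmono i hi h
        · obtain rfl : i = a := by omega
          rw [Function.update_self]
          omega
      · rw [sum_Icc_one_succ, Finset.sum_congr rfl fun i hi => by rw [hne i hi], hsum,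
          Function.update_self, Nat.choose_succ_self_right]
        omega
      · have hc : (a + 2 + 1).choose (a + 1 + 1) = a + 3 := Nat.choose_succ_self_right (a + 2)
        have hs : ∑ i ∈ Icc 1 a, (Function.update n (a + 1) (a + 2) i + 1).choose (i + 1) =
            ∑ i ∈ Icc 1 a, (n i + 1).choose (i + 1) :=
          Finset.sum_congr rfl fun i hi => by rw [hne i hi]
        rw [sum_Icc_one_succ, hs, Function.update_self, hc]
        omega

theorem lt_of_strict_steps {a : ℕ} {n : ℕ → ℕ} (hn : ∀ i, 1 ≤ i → i < a → n i < n (i + 1))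
    {i : ℕ} (hi : 1 ≤ i) (hia : i ≤ a) : n i + (a - i) ≤ n a := by
  induction a, hia using Nat.le_induction with
  | base => simp
  | succ a hia ih =>
    have h1 := ih fun l hl hla => hn l hl (by omega)
    have h2 := hn a (by omega) (by omega)
    omega

/-- A converse of `exists_expansion_growth`. -/
theorem le_of_expansion_growth (a δ : ℕ) (n : ℕ → ℕ) (hna : n a ≤ a + 1)
    (hn : ∀ i, 1 ≤ i → i < a → n i < n (i + 1))
    (h : ∑ i ∈ Icc 1 a, (n i).choose i + δ ≤ ∑ i ∈ Icc 1 a, (n i + 1).choose (i + 1)) :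
    δ ≤ a ∧ ∑ z ∈ range δ, (a + 1 - z) ≤ ∑ i ∈ Icc 1 a, (n i).choose i := by
  induction a generalizing δ with
  | zero =>
    have : δ = 0 := by simpa using h
    simp [this]
  | succ a ih =>
    rcases Nat.lt_or_ge (n (a + 1)) (a + 2) with hlt | hge
    -- Here n i ≤ i for all i, so C(n i, i + 1) = 0 and nothing grows.
    · have hle : ∑ i ∈ Icc 1 (a + 1), (n i + 1).choose (i + 1) ≤
          ∑ i ∈ Icc 1 (a + 1), (n i).choose i := by
        refine Finset.sum_le_sum fun i hi => ?_
        obtain ⟨hi1, hia⟩ := Finset.mem_Icc.mp hi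
        have := lt_of_strict_steps hn hi1 hia
        rw [Nat.choose_succ_succ', Nat.choose_eq_zero_of_lt (n := n i) (k := i + 1) (by omega),
          add_zero]
      obtain rfl : δ = 0 := by omega
      simp
    · have heq : n (a + 1) = a + 2 := by omega
      rcases δ with _ | δ
      · simp
      -- Strictness starts at index 1 and says nothing about `n 0`.
      have hna' : n a ≤ a + 1 ∨ a = 0 := by
        rcases Nat.eq_zero_or_pos a with h0 | h0
        · exact Or.inr h0
        · left
          have := hn a h0 (by omega)
          omega
      have hc : (a + 2 + 1).choose (a + 1 + 1) = a + 3 := Nat.choose_succ_self_right (a + 2)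
      have hc' : (a + 2).choose (a + 1) = a + 2 := Nat.choose_succ_self_right (a + 1)
      rw [sum_Icc_one_succ, sum_Icc_one_succ, heq, hc, hc'] at h
      have hshift : ∑ z ∈ range δ, (a + 1 + 1 - (z + 1)) = ∑ z ∈ range δ, (a + 1 - z) :=
        Finset.sum_congr rfl fun z _ => by omega
      rw [sum_Icc_one_succ, heq, hc', Finset.sum_range_succ', hshift]
      rcases hna' with hna' | rfl
      · obtain ⟨h1, h2⟩ := ih δ hna' (fun i hi hia => hn i hi (by omega)) (by omega)
        omega
      · obtain rfl : δ = 0 := by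
          simp only [Finset.Icc_eq_empty_of_lt zero_lt_one, Finset.sum_empty] at h
          omega
        simp

/-- Induction by Pascal's rule: the lower terms are absorbed by C(n_a + 1, a), since n_{a-1} + 2 ≤
n_a + 1. -/
theorem sum_choose_succ_le {a : ℕ} (ha : 1 ≤ a) {n : ℕ → ℕ}
    (hn : ∀ i, 1 ≤ i → i < a → n i < n (i + 1)) :
    ∑ i ∈ Icc 1 a, (n i + 1).choose (i + 1) ≤ (n a + 2).choose (a + 1) := by
  induction a, ha using Nat.le_induction with
  | base =>
    rw [Finset.Icc_self, Finset.sum_singleton]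
    exact Nat.choose_le_choose _ (by omega)
  | succ a ha ih =>
    have h1 := ih fun i hi hia => hn i hi (by omega)
    have h2 := hn a ha (by omega)
    have h3 : (n a + 2).choose (a + 1) ≤ (n (a + 1) + 1).choose (a + 1) :=
      Nat.choose_le_choose _ (by omega)
    rw [sum_Icc_one_succ, Nat.choose_succ_succ' (n (a + 1) + 1) (a + 1)]
    omega

/-- Macaulay's growth function is bounded by its value at `C(N, a)` up to `C(N, a)`. -/
theorem growth_le_choose {a N : ℕ} (ha : 1 ≤ a) (hN : a ≤ N) {n : ℕ → ℕ}
    (hn : ∀ i, 1 ≤ i → i < a → n i < n (i + 1))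
    (h : ∑ i ∈ Icc 1 a, (n i).choose i ≤ N.choose a) :
    ∑ i ∈ Icc 1 a, (n i + 1).choose (i + 1) ≤ (N + 1).choose (a + 1) := by
  obtain ⟨a, rfl⟩ := Nat.exists_eq_add_of_le' ha
  rw [sum_Icc_one_succ] at h
  have hle : n (a + 1) ≤ N := by
    by_contra! hlt
    have h1 : (N + 1).choose (a + 1) ≤ (n (a + 1)).choose (a + 1) := Nat.choose_le_choose _ hlt
    have h2 : 0 < N.choose a := Nat.choose_pos (by omega)
    rw [Nat.choose_succ_succ'] at h1
    omega
  rcases hle.lt_or_eq with hlt | heq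
  · exact (sum_choose_succ_le ha hn).trans (Nat.choose_le_choose _ (by omega))
  · rw [heq] at h
    -- The leading term exhausts the bound, so the lower binomials vanish, and so do their growths.
    have h0 : ∑ i ∈ Icc 1 a, (n i).choose i = 0 := by omega
    rw [sum_Icc_one_succ, heq, Finset.sum_eq_zero, zero_add]
    intro i hi
    have := Finset.sum_eq_zero_iff.mp h0 i hi
    rw [Nat.choose_eq_zero_iff] at this
    exact Nat.choose_eq_zero_of_lt (by omega)

/-! ### The triples that give SI sequences -/

/-- `MeetsBound` is the closed form of the cardinality of the slab; δ ≤ k + 1 makes the truncated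
subtractions exact. -/
theorem meetsBound_iff {δ k b : ℕ} (hδ : δ ≤ k + 1) :
    MeetsBound δ k b ↔ ∑ z ∈ range δ, (k + 2 - z) ≤ b := by
  have key : ((∑ z ∈ range δ, (k + 2 - z) : ℕ) : ℚ) = (δ : ℚ) * (k + 1) - δ * (δ - 3) / 2 := by
    clear b
    induction δ with
    | zero => simp
    | succ δ ih =>
      rw [Finset.sum_range_succ, Nat.cast_add, ih (by omega), Nat.cast_sub (by omega)]
      push_cast
      ring
  rw [MeetsBound, ← key, Nat.cast_le]

theorem six_mul_sdim (k : ℕ) : 6 * sdim k = (k + 1) * (k + 2) * (k + 3) := by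
  have h := Nat.add_one_mul_choose_eq (k + 2) 2
  have h' := Nat.add_one_mul_choose_eq (k + 1) 1
  simp only [Nat.choose_one_right, Nat.reduceAdd] at h h'
  rw [sdim]
  nlinarith

theorem two_mul_choose_two (k : ℕ) : 2 * (k + 3).choose 2 = (k + 3) * (k + 2) := by
  have h := Nat.add_one_mul_choose_eq (k + 2) 1
  simp only [Nat.choose_one_right, Nat.reduceAdd] at h
  rw [h, mul_comm]

theorem tripleSeq_of_le {δ k b i : ℕ} (hi : i ≤ k) : tripleSeq δ k b i = sdim i := if_pos hi

theorem tripleSeq_add_one (δ k b : ℕ) : tripleSeq δ k b (k + 1) = sdim k + b := by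
  simp [tripleSeq]

theorem tripleSeq_add_two (δ k b : ℕ) : tripleSeq δ k b (k + 2) = sdim k + 2 * b + δ := by
  simp [tripleSeq]

theorem tripleSeq_add_three (δ k b : ℕ) : tripleSeq δ k b (k + 3) = sdim k + b := by
  simp [tripleSeq]

theorem tripleSeq_add_four {δ k b i : ℕ} (hi : i ≤ k) :
    tripleSeq δ k b (k + 4 + i) = sdim (k - i) := by
  rw [tripleSeq, if_neg (by omega), if_neg (by omega), if_neg (by omega), if_neg (by omega),
    if_pos (by omega)]
  congr 1
  omega

theorem tripleSeq_symm {δ k b i : ℕ} (hi : i ≤ 2 * k + 4) :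
    tripleSeq δ k b i = tripleSeq δ k b (2 * k + 4 - i) := by
  wlog h : i ≤ k + 2 generalizing i
  · have := this (i := 2 * k + 4 - i) (by omega) (by omega)
    rw [this]
    congr 1
    omega
  rcases Nat.lt_or_ge k i with h' | h'
  · obtain rfl | rfl : i = k + 1 ∨ i = k + 2 := by omega
    · rw [show 2 * k + 4 - (k + 1) = k + 3 by omega, tripleSeq_add_one, tripleSeq_add_three]
    · rw [show 2 * k + 4 - (k + 2) = k + 2 by omega]
  · rw [show 2 * k + 4 - i = k + 4 + (k - i) by omega, tripleSeq_add_four (by omega),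
      tripleSeq_of_le h']
    congr 1
    omega

/-- Indeed s(s + 2b + δ) - (s + b)² = δs - b² with s = s_k. -/
theorem logConcaveAt_tripleSeq_iff {δ k b : ℕ} :
    LogConcaveAt (tripleSeq δ k b) (k + 1) ↔ δ * sdim k ≤ b ^ 2 := by
  rw [LogConcaveAt, Nat.add_sub_cancel, tripleSeq_of_le le_rfl, tripleSeq_add_one,
    tripleSeq_add_two]
  constructor <;> intro h <;> nlinarith

theorem firstDiff_tripleSeq_of_le {δ k b i : ℕ} (hi : i ≤ k) :
    firstDiff (tripleSeq δ k b) i = ((i + 2).choose 2 : ℕ) := by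
  rcases i with _ | i
  · rw [firstDiff, tripleSeq_of_le hi]
    rfl
  · rw [firstDiff, tripleSeq_of_le hi, tripleSeq_of_le (by omega), sdim, sdim,
      Nat.choose_succ_succ' (i + 3) 2]
    push_cast
    ring

theorem firstDiff_tripleSeq_add_one (δ k b : ℕ) : firstDiff (tripleSeq δ k b) (k + 1) = b := by
  rw [firstDiff, tripleSeq_add_one, tripleSeq_of_le le_rfl]
  push_cast
  ring

theorem firstDiff_tripleSeq_add_two (δ k b : ℕ) :
    firstDiff (tripleSeq δ k b) (k + 2) = (b + δ : ℕ) := by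
  rw [firstDiff, tripleSeq_add_two, tripleSeq_add_one]
  push_cast
  ring

/-- The differences are C(i+2, 2) up to degree k, then b, then b + δ. The lower bound on b serves
only the last step. -/
theorem isSISequence_tripleSeq {δ k b : ℕ} (hk : 1 ≤ k)
    (hb : ∑ z ∈ range δ, (k + 2 - z) ≤ b) (hb' : b < (k + 3).choose 2) :
    IsSISequence 4 (2 * k + 4) (tripleSeq δ k b) := by
  refine ⟨tripleSeq_of_le (Nat.zero_le k), tripleSeq_of_le hk, fun i hi => tripleSeq_symm hi,
    fun i hi => ?_, ?_⟩
  · rw [tripleSeq, if_neg (by omega), if_neg (by omega), if_neg (by omega), if_neg (by omega),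
      if_neg (by omega)]
  rw [show (2 * k + 4) / 2 = k + 2 by omega]
  refine ⟨firstDiff_tripleSeq_of_le (Nat.zero_le k), fun a ha => ?_, fun a ha ha' => ?_⟩
  · rcases Nat.lt_or_ge k a with h | h
    · obtain rfl | rfl : a = k + 1 ∨ a = k + 2 := by omega
      · rw [firstDiff_tripleSeq_add_one]; exact Int.natCast_nonneg _
      · rw [firstDiff_tripleSeq_add_two]; exact Int.natCast_nonneg _
    · rw [firstDiff_tripleSeq_of_le h]; exact Int.natCast_nonneg _
  · rcases Nat.lt_or_ge k a with h | h
    · obtain rfl : a = k + 1 := by omega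
      obtain ⟨n, -, h1, h2, h3⟩ := exists_expansion_growth (k + 1) b δ hb' hb
      rw [firstDiff_tripleSeq_add_one, firstDiff_tripleSeq_add_two]
      exact ⟨n, ⟨h1, by rw [h2]⟩, by exact_mod_cast h3⟩
    · obtain ⟨n, h1, h2⟩ := exists_expansion_choose ha
      rw [firstDiff_tripleSeq_of_le h]
      refine ⟨n, h1, ?_⟩
      rw [h2]
      rcases h.lt_or_eq with h | rfl
      · rw [firstDiff_tripleSeq_of_le h]
      · rw [firstDiff_tripleSeq_add_one]
        exact_mod_cast hb'.le

theorem triple_bounds_of_isSISequence {δ k b : ℕ}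
    (h : IsSISequence 4 (2 * k + 4) (tripleSeq δ k b))
    (hlc : ¬ LogConcaveAt (tripleSeq δ k b) (k + 1)) :
    δ ≤ k + 1 ∧ MeetsBound δ k b ∧ b ^ 2 < δ * sdim k := by
  rw [logConcaveAt_tripleSeq_iff, not_le] at hlc
  obtain ⟨-, h1, -, -, -, -, hmac⟩ := h
  rw [show (2 * k + 4) / 2 = k + 2 by omega] at hmac
  have hb : b ≤ (k + 3).choose (k + 1) := by
    -- Macaulay's condition starts in degree 1; for k = 0 the codimension forces b = 3.
    rcases Nat.eq_zero_or_pos k with rfl | hk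
    · rw [tripleSeq_add_one] at h1
      have : sdim 0 = 1 := rfl
      have h3 : Nat.choose (0 + 3) (0 + 1) = 3 := rfl
      omega
    · obtain ⟨n, ⟨hn, hsum⟩, hle⟩ := hmac k hk (by omega)
      rw [firstDiff_tripleSeq_of_le le_rfl, Nat.cast_inj] at hsum
      rw [firstDiff_tripleSeq_add_one, Nat.cast_le] at hle
      exact hle.trans (growth_le_choose hk (by omega) hn
        (by rw [← hsum, Nat.choose_symm_add]))
  obtain ⟨n, ⟨hn, hsum⟩, hle⟩ := hmac (k + 1) (by omega) (by omega)
  rw [firstDiff_tripleSeq_add_one, Nat.cast_inj] at hsum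
  rw [firstDiff_tripleSeq_add_two, Nat.cast_le] at hle
  rcases Nat.lt_or_ge (n (k + 1)) (k + 3) with hlt | hge
  · obtain ⟨h2, h3⟩ := le_of_expansion_growth (k + 1) δ n (by omega) hn (by rwa [← hsum])
    exact ⟨h2, (meetsBound_iff h2).mpr (by rwa [hsum]), hlc⟩
  -- A leading entry n ≥ k + 3 forces b = C(k+3, 2) and δ ≤ k + 3; then b² < δ s_k would give 3(k+2)
  -- < 2(k+1).
  · exfalso
    have hb2 : (k + 3).choose (k + 1) ≤ b := by
      rw [hsum]
      exact (Nat.choose_le_choose (k + 1) hge).trans (Finset.single_le_sum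
        (f := fun i => (n i).choose i) (fun _ _ => Nat.zero_le _)
        (Finset.mem_Icc.mpr ⟨by omega, le_rfl⟩))
    have hg := hle.trans (growth_le_choose (by omega) (by omega : k + 1 ≤ k + 3) hn
      (by rwa [← hsum]))
    have hc : (k + 3 + 1).choose (k + 1 + 1) = (k + 3).choose (k + 1) + (k + 3) := by
      rw [Nat.choose_succ_succ', Nat.choose_succ_self_right (k + 2)]
    have hsymm : (k + 3).choose (k + 1) = (k + 3).choose 2 :=
      Nat.choose_symm_of_eq_add (by omega)
    have hδ : δ ≤ k + 3 := by omega
    have hs := six_mul_sdim k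
    have h2b : 2 * b = (k + 3) * (k + 2) := by rw [← two_mul_choose_two]; omega
    have hlt : b ^ 2 < (k + 3) * sdim k := hlc.trans_le (Nat.mul_le_mul_right _ hδ)
    have e1 : 12 * b ^ 2 = 3 * ((k + 3) * (k + 2)) ^ 2 := by rw [← h2b]; ring
    have e2 : 12 * ((k + 3) * sdim k) = 2 * (k + 3) * ((k + 1) * (k + 2) * (k + 3)) := by
      rw [← hs]; ring
    nlinarith [Nat.zero_le (k * k), Nat.zero_le (k * k * k), Nat.zero_le (k * k * k * k)]

theorem isNonLogConcaveExample_tripleSeq (F : Type*) [Field F] [Infinite F] {δ k b : ℕ}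
    (hδ : δ ≤ k + 1) (hb : MeetsBound δ k b) (hlt : b ^ 2 < δ * sdim k) :
    IsNonLogConcaveExample F (2 * k + 4) (k + 1) (tripleSeq δ k b) := by
  rw [meetsBound_iff hδ] at hb
  have hk : 1 ≤ k := by
    by_contra! h0
    obtain rfl : k = 0 := by omega
    have : sdim 0 = 1 := rfl
    obtain rfl | rfl : δ = 0 ∨ δ = 1 := by omega
    · omega
    · rw [Finset.sum_range_one] at hb
      nlinarith
  -- Otherwise b² < (k+1) s_k would give 3(k+2)(k+3) < 2(k+1)².
  have hb' : b < (k + 3).choose 2 := by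
    by_contra! hge
    have hs := six_mul_sdim k
    have h2 := two_mul_choose_two k
    have h2b : (k + 3) * (k + 2) ≤ 2 * b := by omega
    have hlt' : b ^ 2 < (k + 1) * sdim k := hlt.trans_le (Nat.mul_le_mul_right _ hδ)
    have e1 : ((k + 3) * (k + 2)) ^ 2 ≤ (2 * b) ^ 2 := Nat.pow_le_pow_left h2b 2
    have e2 : 6 * ((k + 1) * sdim k) = (k + 1) * ((k + 1) * (k + 2) * (k + 3)) := by
      rw [← hs]; ring
    nlinarith [Nat.zero_le (k * k), Nat.zero_le (k * k * k), Nat.zero_le (k * k * k * k)]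
  exact ⟨isSISequence_tripleSeq hk hb hb', isGorensteinSequence_tripleSeq F hk hδ hb hb'.le,
    by omega, by omega, by rwa [logConcaveAt_tripleSeq_iff, not_le]⟩

/-! ### Key entries and length -/

theorem keyEntries_tripleSeq (δ k b : ℕ) : keyEntries (tripleSeq δ k b) k =
    [sdim k, sdim k + b, sdim k + 2 * b + δ, sdim k + b, sdim k] := by
  rw [keyEntries, tripleSeq_of_le le_rfl, tripleSeq_add_one, tripleSeq_add_two,
    tripleSeq_add_three, tripleSeq_add_four (Nat.zero_le k), Nat.sub_zero]

theorem sum_sdim (k : ℕ) : ∑ i ∈ range (k + 1), sdim i = (k + 4).choose 4 := by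
  induction k with
  | zero => rfl
  | succ k ih =>
    rw [Finset.sum_range_succ, ih, sdim, Nat.choose_succ_succ' (k + 4) 3, add_comm]

theorem seqLength_tripleSeq (δ k b : ℕ) : seqLength (tripleSeq δ k b) (2 * k + 4) =
    2 * (k + 4).choose 4 + 3 * sdim k + 4 * b + δ := by
  have h1 : ∑ i ∈ range (k + 1), tripleSeq δ k b i = (k + 4).choose 4 := by
    rw [← sum_sdim]
    exact Finset.sum_congr rfl fun i hi =>
      tripleSeq_of_le (Nat.lt_succ_iff.mp (Finset.mem_range.mp hi))
  have h2 : ∑ i ∈ range (k + 1), tripleSeq δ k b (k + 4 + i) = (k + 4).choose 4 := by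
    rw [← sum_sdim, ← Finset.sum_range_reflect]
    exact Finset.sum_congr rfl fun i hi => by
      have := Finset.mem_range.mp hi
      rw [tripleSeq_add_four (by omega)]
      congr 1
      omega
  rw [seqLength, show 2 * k + 4 + 1 = (k + 4) + (k + 1) by ring, Finset.sum_range_add, h2,
    Finset.sum_range_succ, Finset.sum_range_succ, Finset.sum_range_succ, h1,
    tripleSeq_add_one, tripleSeq_add_two, tripleSeq_add_three]
  ring

/-! ### Numerical examples and asymptotic ranges -/

theorem meetsBound_one_iff {k b : ℕ} : MeetsBound 1 k b ↔ k + 2 ≤ b := by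
  rw [meetsBound_iff (by omega)]
  simp

theorem meetsBound_two_iff {k b : ℕ} : MeetsBound 2 k b ↔ 2 * k + 3 ≤ b := by
  rw [MeetsBound, ← Nat.cast_le (α := ℚ)]
  push_cast
  ring_nf

theorem meetsBound_three_iff {k b : ℕ} : MeetsBound 3 k b ↔ 3 * k + 3 ≤ b := by
  rw [MeetsBound, ← Nat.cast_le (α := ℚ)]
  push_cast
  ring_nf

/-- The bound equals δk - δ(δ-5)/2. -/
theorem meetsBound_of_mul_le {δ k b : ℕ} (hδ : 5 ≤ δ) (h : δ * k ≤ b) : MeetsBound δ k b := by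
  have h5 : (5 : ℚ) ≤ δ := by exact_mod_cast hδ
  have hb : (δ * k : ℚ) ≤ b := by exact_mod_cast h
  rw [MeetsBound]
  nlinarith

theorem tripleSeq_one_five_seven : tripleSeq 1 5 7 =
    seqOfList [1, 4, 10, 20, 35, 56, 63, 71, 63, 56, 35, 20, 10, 4, 1] := by
  ext i
  rcases Nat.lt_or_ge i 15 with h | h
  · interval_cases i <;> rfl
  · rw [seqOfList, List.getD_eq_default _ _ (by simpa using h), tripleSeq, if_neg (by omega),
      if_neg (by omega), if_neg (by omega), if_neg (by omega), if_neg (by omega)]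

theorem tripleSeq_one_six_eight : tripleSeq 1 6 8 =
    seqOfList [1, 4, 10, 20, 35, 56, 84, 92, 101, 92, 84, 56, 35, 20, 10, 4, 1] := by
  ext i
  rcases Nat.lt_or_ge i 17 with h | h
  · interval_cases i <;> rfl
  · rw [seqOfList, List.getD_eq_default _ _ (by simpa using h), tripleSeq, if_neg (by omega),
      if_neg (by omega), if_neg (by omega), if_neg (by omega), if_neg (by omega)]

theorem floor_sqrt_two_mul_sdim : ⌊√(2 * (sdim 25 : ℝ))⌋₊ = 80 := by
  have h : sdim 25 = 3276 := by
    have := six_mul_sdim 25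
    omega
  rw [h, Nat.floor_eq_iff (Real.sqrt_nonneg _)]
  constructor
  · exact Real.le_sqrt_of_sq_le (by norm_num)
  · rw [Real.sqrt_lt' (by norm_num)]
    norm_num

/-- Squaring clears the exponent 3/2 and turns the real ranges for b into polynomial inequalities.
-/
theorem sq_rpow_three_halves {x : ℝ} (hx : 0 ≤ x) : (x ^ (3 / 2 : ℝ)) ^ 2 = x ^ 3 := by
  rw [← Real.rpow_natCast, ← Real.rpow_mul hx, ← Real.rpow_natCast]
  norm_num

theorem sq_sqrt_mul_rpow_div {x y : ℝ} (hx : 0 ≤ x) (hy : 0 ≤ y) :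
    (x ^ (1 / 2 : ℝ) * y ^ (3 / 2 : ℝ) / (6 : ℝ) ^ (3 / 2 : ℝ)) ^ 2 = x * y ^ 3 / 216 := by
  rw [div_pow, mul_pow, sq_rpow_three_halves hy, sq_rpow_three_halves (by norm_num),
    ← Real.sqrt_eq_rpow, Real.sq_sqrt hx]
  norm_num

theorem proposition3p2 (F : Type*) [Field F] [Infinite F] :
    -- there are codimension four SI (Gorenstein) sequences that are not log-concave
    (∃ (j : ℕ) (h : ℕ → ℕ), IsSISequence 4 j h ∧ IsGorensteinSequence F 4 h ∧
      ¬ IsLogConcave h j) ∧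
    -- the general triple
    (∀ δ k b : ℕ, 1 ≤ δ → δ ≤ k + 1 → MeetsBound δ k b → b ^ 2 < δ * sdim k →
      IsNonLogConcaveExample F (2 * k + 4) (k + 1) (tripleSeq δ k b) ∧
      keyEntries (tripleSeq δ k b) k =
        [sdim k, sdim k + b, sdim k + 2 * b + δ, sdim k + b, sdim k] ∧
      seqLength (tripleSeq δ k b) (2 * k + 4) = 2 * (k + 4).choose 4 + 3 * sdim k + 4 * b + δ) ∧
    -- no other triples occur
    (∀ δ k b : ℕ, 1 ≤ δ → IsSISequence 4 (2 * k + 4) (tripleSeq δ k b) →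
      ¬ LogConcaveAt (tripleSeq δ k b) (k + 1) →
      δ ≤ k + 1 ∧ MeetsBound δ k b ∧ b ^ 2 < δ * sdim k) ∧
    -- δ = 1: the examples, the first of which is the smallest
    (IsNonLogConcaveExample F 14 6
        (seqOfList [1, 4, 10, 20, 35, 56, 63, 71, 63, 56, 35, 20, 10, 4, 1]) ∧
      tripleSeq 1 5 7 = seqOfList [1, 4, 10, 20, 35, 56, 63, 71, 63, 56, 35, 20, 10, 4, 1] ∧
      seqLength (tripleSeq 1 5 7) 14 = 449 ∧
      (∀ k b : ℕ, IsSISequence 4 (2 * k + 4) (tripleSeq 1 k b) →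
        ¬ LogConcaveAt (tripleSeq 1 k b) (k + 1) → 5 ≤ k ∧ 7 ≤ b)) ∧
    (IsNonLogConcaveExample F 16 7
        (seqOfList [1, 4, 10, 20, 35, 56, 84, 92, 101, 92, 84, 56, 35, 20, 10, 4, 1]) ∧
      tripleSeq 1 6 8 =
        seqOfList [1, 4, 10, 20, 35, 56, 84, 92, 101, 92, 84, 56, 35, 20, 10, 4, 1] ∧
      seqLength (tripleSeq 1 6 8) 16 = 705) ∧
    (IsNonLogConcaveExample F 16 7 (tripleSeq 1 6 9) ∧
      keyEntries (tripleSeq 1 6 9) 6 = [84, 93, 103, 93, 84] ∧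
      seqLength (tripleSeq 1 6 9) 16 = 709) ∧
    -- δ = 1: a range of b, nonempty for large k
    (∀ k b : ℕ, k + 2 ≤ b → (b : ℝ) ≤ ((k : ℝ) / 6) ^ (3 / 2 : ℝ) →
      IsNonLogConcaveExample F (2 * k + 4) (k + 1) (tripleSeq 1 k b)) ∧
    (∃ k₀ : ℕ, ∀ k : ℕ, k₀ ≤ k →
      ∃ b : ℕ, k + 2 ≤ b ∧ (b : ℝ) ≤ ((k : ℝ) / 6) ^ (3 / 2 : ℝ)) ∧
    -- δ = 2: the examples, the first of which is the smallest
    (IsNonLogConcaveExample F 24 11 (tripleSeq 2 10 23) ∧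
      keyEntries (tripleSeq 2 10 23) 10 = [286, 309, 334, 309, 286] ∧
      seqLength (tripleSeq 2 10 23) 24 = 2954 ∧
      (∀ k b : ℕ, IsSISequence 4 (2 * k + 4) (tripleSeq 2 k b) →
        ¬ LogConcaveAt (tripleSeq 2 k b) (k + 1) → 10 ≤ k ∧ 23 ≤ b)) ∧
    (IsNonLogConcaveExample F 26 12 (tripleSeq 2 11 25) ∧
      keyEntries (tripleSeq 2 11 25) 11 = [364, 389, 416, 389, 364] ∧
      seqLength (tripleSeq 2 11 25) 26 = 3924) ∧
    (IsNonLogConcaveExample F 26 12 (tripleSeq 2 11 26) ∧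
      keyEntries (tripleSeq 2 11 26) 11 = [364, 390, 418, 390, 364]) ∧
    ((∀ b : ℕ, 27 ≤ b → b ≤ 30 → IsNonLogConcaveExample F 28 13 (tripleSeq 2 12 b)) ∧
      keyEntries (tripleSeq 2 12 27) 12 = [455, 482, 511, 482, 455]) ∧
    -- δ = 2: for every k ≥ 10 the lowest b = 2k + 3 is possible
    (∀ k : ℕ, 10 ≤ k → (2 * k + 3) ^ 2 < 2 * sdim k ∧
      IsNonLogConcaveExample F (2 * k + 4) (k + 1) (tripleSeq 2 k (2 * k + 3)) ∧
      keyEntries (tripleSeq 2 k (2 * k + 3)) k =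
        [sdim k, sdim k + 2 * k + 3, sdim k + 4 * k + 8, sdim k + 2 * k + 3, sdim k] ∧
      seqLength (tripleSeq 2 k (2 * k + 3)) (2 * k + 4) =
        2 * (k + 4).choose 4 + 3 * sdim k + 8 * k + 14) ∧
    -- δ = 2: every b from 2k + 3 up to √(2 s_k) is possible
    (∀ k b : ℕ, 2 * k + 3 ≤ b → (b : ℝ) < √(2 * (sdim k : ℝ)) →
      IsNonLogConcaveExample F (2 * k + 4) (k + 1) (tripleSeq 2 k b) ∧
      keyEntries (tripleSeq 2 k b) k =
        [sdim k, sdim k + b, sdim k + 2 * b + 2, sdim k + b, sdim k] ∧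
      seqLength (tripleSeq 2 k b) (2 * k + 4) = 2 * (k + 4).choose 4 + 3 * sdim k + 4 * b + 2) ∧
    ⌊√(2 * (sdim 25 : ℝ))⌋₊ = 80 ∧
    IsNonLogConcaveExample F 54 26 (tripleSeq 2 25 80) ∧
    -- δ = 3: examples, the first of which is the smallest
    (IsNonLogConcaveExample F 32 15 (tripleSeq 3 14 45) ∧
      keyEntries (tripleSeq 3 14 45) 14 = [680, 725, 773, 725, 680] ∧
      (∀ k b : ℕ, IsSISequence 4 (2 * k + 4) (tripleSeq 3 k b) →
        ¬ LogConcaveAt (tripleSeq 3 k b) (k + 1) → 14 ≤ k ∧ 45 ≤ b)) ∧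
    (IsNonLogConcaveExample F 38 18 (tripleSeq 3 17 57) ∧
      keyEntries (tripleSeq 3 17 57) 17 = [1140, 1197, 1257, 1197, 1140]) ∧
    (IsNonLogConcaveExample F 40 19 (tripleSeq 3 18 57) ∧
      keyEntries (tripleSeq 3 18 57) 18 = [1330, 1387, 1447, 1387, 1330]) ∧
    -- δ ≥ 4: a range of b, nonempty for large k
    (∀ δ k b : ℕ, 4 ≤ δ → 1 ≤ k → MeetsBound δ k b → δ * k ≤ b →
      (b : ℝ) ≤ (δ : ℝ) ^ (1 / 2 : ℝ) * (k : ℝ) ^ (3 / 2 : ℝ) / (6 : ℝ) ^ (3 / 2 : ℝ) →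
      IsNonLogConcaveExample F (2 * k + 4) (k + 1) (tripleSeq δ k b)) ∧
    (∀ δ k b : ℕ, 5 ≤ δ → δ * k ≤ b → MeetsBound δ k b) ∧
    (∀ δ : ℕ, 4 ≤ δ → ∃ k₀ : ℕ, ∀ k : ℕ, k₀ ≤ k → ∃ b : ℕ, MeetsBound δ k b ∧ δ * k ≤ b ∧
      (b : ℝ) ≤ (δ : ℝ) ^ (1 / 2 : ℝ) * (k : ℝ) ^ (3 / 2 : ℝ) / (6 : ℝ) ^ (3 / 2 : ℝ)) := by
  have hex : ∀ δ k b : ℕ, δ ≤ k + 1 → MeetsBound δ k b → b ^ 2 < δ * sdim k →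
      IsNonLogConcaveExample F (2 * k + 4) (k + 1) (tripleSeq δ k b) :=
    fun δ k b => isNonLogConcaveExample_tripleSeq F
  -- The factor 6 replaces s_k by a product, so numerical cases involve no binomials.
  have hex' : ∀ δ k b : ℕ, δ ≤ k + 1 → MeetsBound δ k b →
      6 * b ^ 2 < δ * ((k + 1) * (k + 2) * (k + 3)) →
      IsNonLogConcaveExample F (2 * k + 4) (k + 1) (tripleSeq δ k b) := by
    intro δ k b h1 h2 h3
    refine hex δ k b h1 h2 ?_
    rw [← six_mul_sdim] at h3
    nlinarith
  have h157 := hex' 1 5 7 (by norm_num) (meetsBound_one_iff.mpr (by norm_num)) (by norm_num)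
  have h168 := hex' 1 6 8 (by norm_num) (meetsBound_one_iff.mpr (by norm_num)) (by norm_num)
  refine ⟨⟨14, _, h157.1, h157.2.1, fun h => h157.2.2.2.2 (h 6 (by norm_num) (by norm_num))⟩,
    fun δ k b _ h1 h2 h3 =>
      ⟨hex δ k b h1 h2 h3, keyEntries_tripleSeq δ k b, seqLength_tripleSeq δ k b⟩,
    fun δ k b _ => triple_bounds_of_isSISequence,
    ⟨tripleSeq_one_five_seven ▸ h157, tripleSeq_one_five_seven,
      (seqLength_tripleSeq 1 5 7).trans (by norm_num [sdim, Nat.choose]), fun k b h h' => ?_⟩,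
    ⟨tripleSeq_one_six_eight ▸ h168, tripleSeq_one_six_eight,
      (seqLength_tripleSeq 1 6 8).trans (by norm_num [sdim, Nat.choose])⟩,
    ⟨hex' 1 6 9 (by norm_num) (meetsBound_one_iff.mpr (by norm_num)) (by norm_num),
      (keyEntries_tripleSeq 1 6 9).trans (by norm_num [sdim, Nat.choose]),
      (seqLength_tripleSeq 1 6 9).trans (by norm_num [sdim, Nat.choose])⟩,
    -- With b = k + 2 ≤ 2k one has 216 b² ≤ 864 k² ≤ k³ once k ≥ 864, where 216 = 6³.
    fun k b h h' => ?_, ⟨864, fun k hk => ⟨k + 2, le_rfl, ?_⟩⟩,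
    ⟨hex' 2 10 23 (by norm_num) (meetsBound_two_iff.mpr (by norm_num)) (by norm_num),
      (keyEntries_tripleSeq 2 10 23).trans (by norm_num [sdim, Nat.choose]),
      (seqLength_tripleSeq 2 10 23).trans (by norm_num [sdim, Nat.choose]), fun k b h h' => ?_⟩,
    ⟨hex' 2 11 25 (by norm_num) (meetsBound_two_iff.mpr (by norm_num)) (by norm_num),
      (keyEntries_tripleSeq 2 11 25).trans (by norm_num [sdim, Nat.choose]),
      (seqLength_tripleSeq 2 11 25).trans (by norm_num [sdim, Nat.choose])⟩,
    ⟨hex' 2 11 26 (by norm_num) (meetsBound_two_iff.mpr (by norm_num)) (by norm_num),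
      (keyEntries_tripleSeq 2 11 26).trans (by norm_num [sdim, Nat.choose])⟩,
    ⟨fun b h h' => hex' 2 12 b (by norm_num) (meetsBound_two_iff.mpr (by omega)) (by nlinarith),
      (keyEntries_tripleSeq 2 12 27).trans (by norm_num [sdim, Nat.choose])⟩,
    fun k hk => ?_, fun k b h h' => ?_, floor_sqrt_two_mul_sdim,
    hex' 2 25 80 (by norm_num) (meetsBound_two_iff.mpr (by norm_num)) (by norm_num),
    ⟨hex' 3 14 45 (by norm_num) (meetsBound_three_iff.mpr (by norm_num)) (by norm_num),
      (keyEntries_tripleSeq 3 14 45).trans (by norm_num [sdim, Nat.choose]), fun k b h h' => ?_⟩,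
    ⟨hex' 3 17 57 (by norm_num) (meetsBound_three_iff.mpr (by norm_num)) (by norm_num),
      (keyEntries_tripleSeq 3 17 57).trans (by norm_num [sdim, Nat.choose])⟩,
    ⟨hex' 3 18 57 (by norm_num) (meetsBound_three_iff.mpr (by norm_num)) (by norm_num),
      (keyEntries_tripleSeq 3 18 57).trans (by norm_num [sdim, Nat.choose])⟩,
    fun δ k b hδ hk hb hδk h => ?_, fun δ k b hδ h => meetsBound_of_mul_le hδ h,
    -- With b = δ(k+1), the bound (k+1)² ≤ 4k² gives 216 b² ≤ 864 δ² k² ≤ δ k³ once k ≥ 864 δ.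
    fun δ hδ => ⟨864 * δ, fun k hk => ⟨δ * (k + 1), ?_, Nat.mul_le_mul_left δ (Nat.le_succ k), ?_⟩⟩⟩
  · obtain ⟨-, hb, hlt⟩ := triple_bounds_of_isSISequence h h'
    rw [meetsBound_one_iff] at hb
    have hs := six_mul_sdim k
    -- For each k ≤ 4 one has (k+2)² ≥ s_k; the case k = 4 is tight, 36 against 35.
    have hk : 5 ≤ k := by
      by_contra! hk
      have : (k + 2) ^ 2 ≤ b ^ 2 := Nat.pow_le_pow_left hb 2
      interval_cases k <;> omega
    omega
  · have h2 := pow_le_pow_left₀ (Nat.cast_nonneg b) h' 2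
    have h3 : (216 * b ^ 2 : ℕ) ≤ k ^ 3 := by
      rw [sq_rpow_three_halves (by positivity), div_pow] at h2
      have : (216 * b ^ 2 : ℝ) ≤ k ^ 3 := by linarith
      exact_mod_cast this
    exact hex' 1 k b (by omega) (meetsBound_one_iff.mpr h) (by nlinarith)
  · refine (pow_le_pow_iff_left₀ (by positivity) (by positivity) two_ne_zero).mp ?_
    rw [sq_rpow_three_halves (by positivity), div_pow]
    have hk' : (864 : ℝ) ≤ k := by exact_mod_cast hk
    push_cast
    rw [le_div_iff₀ (by norm_num)]
    nlinarith [mul_le_mul_of_nonneg_right hk' (sq_nonneg (k : ℝ))]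
  · obtain ⟨-, hb, hlt⟩ := triple_bounds_of_isSISequence h h'
    rw [meetsBound_two_iff] at hb
    have hs := six_mul_sdim k
    -- Again tight: for k = 9, (2k+3)² = 441 while 2 s_k = 440.
    have hk : 10 ≤ k := by
      by_contra! hk
      have : (2 * k + 3) ^ 2 ≤ b ^ 2 := Nat.pow_le_pow_left hb 2
      interval_cases k <;> omega
    omega
  · have hlt : (2 * k + 3) ^ 2 < 2 * sdim k := by
      have hs := six_mul_sdim k
      have : 3 * (2 * k + 3) ^ 2 < (k + 1) * (k + 2) * (k + 3) := by
        obtain ⟨m, rfl⟩ := Nat.exists_eq_add_of_le hk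
        ring_nf
        nlinarith [Nat.zero_le (m ^ 2), Nat.zero_le (m ^ 3)]
      omega
    refine ⟨hlt, hex 2 k _ (by omega) (meetsBound_two_iff.mpr le_rfl) hlt, ?_, ?_⟩
    · rw [keyEntries_tripleSeq]
      simp only [List.cons.injEq, and_true, true_and]
      omega
    · rw [seqLength_tripleSeq]
      ring
  · refine ⟨hex 2 k b ?_ (meetsBound_two_iff.mpr h) ?_, keyEntries_tripleSeq 2 k b,
      seqLength_tripleSeq 2 k b⟩
    · by_contra! hk
      obtain rfl : k = 0 := by omega
      rw [Real.lt_sqrt (Nat.cast_nonneg b), show sdim 0 = 1 from rfl] at h'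
      have h3 : (3 : ℝ) ≤ b := by exact_mod_cast h
      norm_num at h'
      nlinarith
    · rw [Real.lt_sqrt (Nat.cast_nonneg b)] at h'
      exact_mod_cast h'
  · obtain ⟨-, hb, hlt⟩ := triple_bounds_of_isSISequence h h'
    rw [meetsBound_three_iff] at hb
    have hs := six_mul_sdim k
    have hk : 14 ≤ k := by
      by_contra! hk
      have : (3 * k + 3) ^ 2 ≤ b ^ 2 := Nat.pow_le_pow_left hb 2
      interval_cases k <;> omega
    omega
  · have h2 : 216 * b ^ 2 ≤ δ * k ^ 3 := by
      have h2 := pow_le_pow_left₀ (Nat.cast_nonneg b) h 2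
      rw [sq_sqrt_mul_rpow_div (Nat.cast_nonneg δ) (Nat.cast_nonneg k)] at h2
      have : (216 * b ^ 2 : ℝ) ≤ δ * k ^ 3 := by linarith
      exact_mod_cast this
    have h3 : (δ * k) ^ 2 ≤ b ^ 2 := Nat.pow_le_pow_left hδk 2
    -- Together the two bounds on b give 216 δ² k² ≤ δ k³. This supplies δ ≤ k + 1, which is not
    -- assumed.
    have h4 : 216 * δ ≤ k := by
      have hpos : 0 < δ * k ^ 2 := by positivity
      refine Nat.le_of_mul_le_mul_left ?_ hpos
      nlinarith
    refine hex' δ k b (by omega) hb ?_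
    nlinarith [Nat.mul_le_mul_left δ (show k ^ 3 ≤ (k + 1) * (k + 2) * (k + 3) by nlinarith),
      Nat.mul_pos (show 0 < δ by omega) (show 0 < (k + 1) * (k + 2) * (k + 3) by positivity)]
  · have h4 : (4 : ℚ) ≤ δ := by exact_mod_cast hδ
    rw [MeetsBound]
    push_cast
    nlinarith
  · refine (pow_le_pow_iff_left₀ (by positivity) (by positivity) two_ne_zero).mp ?_
    rw [sq_sqrt_mul_rpow_div (Nat.cast_nonneg δ) (Nat.cast_nonneg k), le_div_iff₀ (by norm_num)]
    have h1 : 216 * δ * (k + 1) ^ 2 ≤ k ^ 3 := by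
      have : (k + 1) ^ 2 ≤ (2 * k) ^ 2 := Nat.pow_le_pow_left (by omega) 2
      nlinarith [Nat.mul_le_mul_right (k ^ 2) hk, Nat.mul_le_mul_left (216 * δ) this]
    have h2 : (δ * (k + 1)) ^ 2 * 216 ≤ δ * k ^ 3 := by
      nlinarith [Nat.mul_le_mul_left δ h1]
    exact_mod_cast h2
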